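/- Let $\Omega(n)$ denote the number of prime factors of $n$ counted with multiplicity, let $p$ always denote a prime, and for integers $k\ge 1$, $y\ge 2$ put $$f_{k,y}=\sum_{\substack{\Omega(n)=k\\ p\mid n\Rightarrow p>y}}\frac{1}{n\log n}.$$ For every integer $y\ge 2$ we have $$f_{k,y}=\prod_{p\le y}\left(1-\frac1p\right)+\frac{c_y d_y}{2^k}+O_y\!\left(\frac{k^3}{3^k}\right)$$ uniformly for $k\ge 1$ (the implied constant depends only on $y$), where $$c_y=\gamma+\sum_{p\le y}\frac{\log p}{p-1}-\sum_{p>y}\frac{\log p}{(p-1)(p-2)},\qquad d_y=d\prod_{2<p\le y}\left(1-\frac2p\right),$$ $$d=\frac14\prod_{p>2}\left(1-\frac2p\right)^{-1}\left(1-\frac1p\right)^2,$$ $\gamma$ is the Euler--Mascheroni constant, and all the infinite series and products above converge. -/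

import Mathlib

namespace ErdosSum

/-- The positive integers `n` having exactly `k` prime factors, counted with multiplicity,
all of which exceed `y`. -/
def roughAlmostPrimes (k y : ℕ) : Set ℕ :=
  {n | n ≠ 0 ∧ ArithmeticFunction.cardFactors n = k ∧ ∀ p : ℕ, p.Prime → p ∣ n → y < p}

/-- The general term `1 / (n log n)`. -/
noncomputable def term (n : ℕ) : ℝ := 1 / ((n : ℝ) * Real.log n)

/-- The sifted Erdős sum `f_{k,y}`. -/
noncomputable def f (k y : ℕ) : ℝ := ∑' n : roughAlmostPrimes k y, term n

/-- The primes `p ≤ y`. -/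
def primesUpTo (y : ℕ) : Finset ℕ := {p ∈ Finset.Icc 1 y | p.Prime}

/-- The primes `p > y`. -/
def primesAbove (y : ℕ) : Set ℕ := {p | p.Prime ∧ y < p}

/-- The term `log p / ((p - 1) (p - 2))` of the series in `c_y`. -/
noncomputable def cTerm (p : ℕ) : ℝ := Real.log p / (((p : ℝ) - 1) * ((p : ℝ) - 2))

/-- The constant `c_y`. -/
noncomputable def c (y : ℕ) : ℝ :=
  Real.eulerMascheroniConstant + ∑ p ∈ primesUpTo y, Real.log p / ((p : ℝ) - 1)
    - ∑' p : primesAbove y, cTerm p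

/-- The Euler factor `(1 - 2/p)⁻¹ (1 - 1/p)²` of the product in `d`. -/
noncomputable def dFactor (p : ℕ) : ℝ := (1 - 2 / (p : ℝ))⁻¹ * (1 - 1 / (p : ℝ)) ^ 2

/-- The constant `d`. -/
noncomputable def d : ℝ := 1 / 4 * ∏' p : primesAbove 2, dFactor p

/-- The constant `d_y = d ∏_{2 < p ≤ y} (1 - 2/p)`. -/
noncomputable def dSifted (y : ℕ) : ℝ :=
  d * ∏ p ∈ primesUpTo y with 2 < p, (1 - 2 / (p : ℝ))

end ErdosSum

namespace ErdosSum

/-! Since 1/(n log n) is the integral of n^(-(1+x)) over x > 0, `f k y` is the integral over (0,1]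
of P_k(1+x), where P_k(s) = `roughSum k y s`, up to an error at most P_k(2) coming from x > 1
(`f_eq_integral`).

Newton's identity (`succ_mul_roughSum`) gives ∑ P_k(s) X^k = exp(∑_{m ≥ 1} P(ms) X^m / m), where
P(w) = ∑_{p > y} p^(-w). At s = 1 + x the only singularity as x → 0 is P(1+x) = -log x + (smooth),
read off from ζ (`primeSum_eq`). Hence the generating series is exp(-X log x) · exp(R_x(X)), with
R_x = `regSeries y x` smooth in x. All primes involved are at least 3, and 3 enters at most once, as
-log(1 - X/3), while the other primes give radius 5 up to the linear term; so the coefficients of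
exp R_x are O(3^(-n)) uniformly in x (`exists_abs_coeff_expS_le`).

Expanding exp R_x = A + xB + O(x^2) coefficientwise and integrating x^i (-log x)^j / j! to
(i+1)^(-(j+1)) turns the A part into the partial sum of A(1), the B part into 2^(-(k+1)) times the
partial sum of B(2), and the remainder into O(k^3 3^(-k)). Completing the sums costs only O(k
3^(-k)), because the evaluation points 1 and 2 lie inside the disc of radius 3. Finally A(1) = ∏_{p
≤ y} (1 - 1/p), A(2) = d_y and B(2) = A(2) · 2c_y (`exists_regular_expansion`). -/

open PowerSeries Finset MeasureTheory

variable {y : ℕ}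

/-! ### Formal exponentials and bounds for their coefficients. -/

/-- The formal exponential of a power series without constant term. -/
noncomputable def expS (L : ℝ⟦X⟧) : ℝ⟦X⟧ := (PowerSeries.exp ℝ).subst L

lemma derivative_expS {L : ℝ⟦X⟧} (hL : constantCoeff L = 0) :
    d⁄dX ℝ (expS L) = expS L * d⁄dX ℝ L := by
  have h : HasSubst L := HasSubst.of_constantCoeff_zero' hL
  rw [expS, derivative_subst h, PowerSeries.derivative_exp]

lemma coeff_zero_expS {L : ℝ⟦X⟧} (hL : constantCoeff L = 0) : coeff 0 (expS L) = 1 := by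
  have h : HasSubst L := HasSubst.of_constantCoeff_zero' hL
  have h1 : PowerSeries.exp ℝ = 1 + (PowerSeries.exp ℝ - 1) := by ring
  have h2 : constantCoeff ((PowerSeries.exp ℝ - 1 : ℝ⟦X⟧).subst L) = 0 :=
    constantCoeff_subst_eq_zero hL _ (by simp)
  have h3 : (1 : ℝ⟦X⟧).subst L = 1 := by rw [← coe_substAlgHom h, map_one]
  rw [coeff_zero_eq_constantCoeff_apply, expS, h1, subst_add h, map_add, h3]
  erw [h2]
  simp

/-- The equation F' = F L' determines each coefficient from the earlier ones. Every closed form for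
an exponential below is obtained this way. -/
lemma expS_unique {L F : ℝ⟦X⟧} (hL : constantCoeff L = 0) (h0 : coeff 0 F = 1)
    (hF : d⁄dX ℝ F = F * d⁄dX ℝ L) : F = expS L := by
  ext n
  induction n using Nat.strong_induction_on with
  | _ n ih =>
    cases n with
    | zero => rw [h0, coeff_zero_expS hL]
    | succ n =>
      have h1 := congrArg (coeff n) hF
      have h2 := congrArg (coeff n) (derivative_expS hL)
      rw [coeff_derivative, coeff_mul] at h1 h2
      have : ∑ p ∈ antidiagonal n, coeff p.1 F * coeff p.2 (d⁄dX ℝ L) =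
          ∑ p ∈ antidiagonal n, coeff p.1 (expS L) * coeff p.2 (d⁄dX ℝ L) := by
        refine sum_congr rfl fun p hp => ?_
        rw [ih p.1 (by have := mem_antidiagonal.1 hp; omega)]
      rw [this, ← h2] at h1
      exact mul_right_cancel₀ (by positivity) h1

lemma expS_add {L M : ℝ⟦X⟧} (hL : constantCoeff L = 0) (hM : constantCoeff M = 0) :
    expS (L + M) = expS L * expS M := by
  symm
  apply expS_unique (by simp [hL, hM])
  · rw [coeff_mul]
    simp [coeff_zero_expS hL, coeff_zero_expS hM]
  · rw [Derivation.leibniz, derivative_expS hL, derivative_expS hM, map_add]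
    simp only [smul_eq_mul]; ring

lemma succ_mul_coeff_expS {L : ℝ⟦X⟧} (hL : constantCoeff L = 0) (n : ℕ) :
    coeff (n + 1) (expS L) * (n + 1) =
      ∑ p ∈ antidiagonal n, coeff p.1 (expS L) * (coeff (p.2 + 1) L * (p.2 + 1)) := by
  have h2 := congrArg (coeff n) (derivative_expS hL)
  rw [coeff_derivative, coeff_mul] at h2
  simpa only [coeff_derivative] using h2

/-- Majorant principle: the recursion `succ_mul_coeff_expS` has nonnegative weights, so domination
passes from exponents to exponentials by induction. -/
lemma abs_coeff_expS_le {L M : ℝ⟦X⟧} (hL : constantCoeff L = 0) (hM : constantCoeff M = 0)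
    (h : ∀ m, |coeff m L| ≤ coeff m M) (n : ℕ) : |coeff n (expS L)| ≤ coeff n (expS M) := by
  induction n using Nat.strong_induction_on with
  | _ n ih =>
    cases n with
    | zero => rw [coeff_zero_expS hL, coeff_zero_expS hM]; simp
    | succ n =>
      have h1 := succ_mul_coeff_expS hL n
      have h2 := succ_mul_coeff_expS hM n
      have hn : (0 : ℝ) < n + 1 := by positivity
      refine le_of_mul_le_mul_right ?_ hn
      rw [h2]
      nth_rewrite 1 [← abs_of_pos hn]
      rw [← abs_mul, h1]
      refine (abs_sum_le_sum_abs _ _).trans (sum_le_sum fun p hp => ?_)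
      have hp' := mem_antidiagonal.1 hp
      have hp2 : (0 : ℝ) < p.2 + 1 := by positivity
      rw [abs_mul, abs_mul, abs_of_pos hp2]
      have := ih p.1 (by omega)
      have h3 := h (p.2 + 1)
      have h4 : 0 ≤ coeff p.1 (expS M) := (abs_nonneg _).trans this
      gcongr

lemma coeff_expS_X (t : ℝ) (n : ℕ) : coeff n (expS (t • X)) = t ^ n / n.factorial := by
  have : expS (t • X) = mk fun n => t ^ n / n.factorial := by
    symm
    apply expS_unique (by simp) (by simp)
    ext n
    rw [coeff_derivative]
    rw [Derivation.map_smul, derivative_X, mul_smul_comm, mul_one, PowerSeries.coeff_smul]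
    simp only [coeff_mk, smul_eq_mul]
    rw [Nat.factorial_succ]; push_cast
    field_simp
    ring
  rw [this, coeff_mk]

/-- The power series `-log (1 - r X)`. -/
noncomputable def logSeries (r : ℝ) : ℝ⟦X⟧ := mk fun m => r ^ m / m

lemma constantCoeff_logSeries (r : ℝ) : constantCoeff (logSeries r) = 0 := by
  rw [← coeff_zero_eq_constantCoeff_apply]; simp [logSeries]

lemma coeff_expS_logSeries (r : ℝ) (n : ℕ) : coeff n (expS (logSeries r)) = r ^ n := by
  have : expS (logSeries r) = mk fun n => r ^ n := by
    symm
    apply expS_unique (constantCoeff_logSeries r) (by simp)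
    ext n
    rw [coeff_derivative, coeff_mul]
    have : ∀ p ∈ antidiagonal n, coeff p.1 (mk fun n => r ^ n) *
        coeff p.2 (d⁄dX ℝ (logSeries r)) = r ^ (n + 1) := by
      intro p hp
      rw [coeff_derivative, logSeries, coeff_mk, coeff_mk, ← mem_antidiagonal.1 hp]
      push_cast
      field_simp
      ring
    rw [sum_congr rfl this]
    simp [mul_comm]
  rw [this, coeff_mk]

lemma sum_antidiagonal_pow_le {r : ℝ} (h0 : 0 ≤ r) (h1 : r < 1) (n : ℕ) :
    ∑ p ∈ antidiagonal n, r ^ p.2 ≤ (1 - r)⁻¹ := by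
  rw [← Nat.sum_antidiagonal_swap, Nat.sum_antidiagonal_eq_sum_range_succ_mk]
  rw [← tsum_geometric_of_lt_one h0 h1]
  exact (summable_geometric_of_lt_one h0 h1).sum_le_tsum _ fun _ _ => by positivity

/-- The series is (1 - X/5)^(-K), of radius 5, so any radius below 5 serves; 4 leaves room above 3.
-/
lemma coeff_expS_smul_logSeries_le {K : ℝ} (hK : 0 ≤ K) :
    ∃ M : ℝ, 0 ≤ M ∧ ∀ n, coeff n (expS (K • logSeries (1 / 5))) ≤ M * (1 / 4) ^ n := by
  set e : ℕ → ℝ := fun n => coeff n (expS (K • logSeries (1 / 5))) with he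
  have hc : constantCoeff (K • logSeries (1 / 5)) = 0 := by
    simp [constantCoeff_logSeries]
  have hpos : ∀ n, 0 ≤ e n := fun n => (abs_nonneg _).trans
    (abs_coeff_expS_le hc hc (fun m => by
      rw [abs_of_nonneg]; simp only [logSeries, map_smul, coeff_mk, smul_eq_mul]; positivity) n)
  obtain ⟨N, hN⟩ := exists_nat_ge (4 * K)
  have hrec : ∀ n : ℕ, e (n + 1) * (n + 1) =
      K * ∑ p ∈ antidiagonal n, e p.1 * (1 / 5) ^ (p.2 + 1) := by
    intro n
    rw [he, succ_mul_coeff_expS hc, mul_sum]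
    refine sum_congr rfl fun p _ => ?_
    simp only [logSeries, map_smul, coeff_mk, smul_eq_mul]
    push_cast
    field_simp
  -- This M makes the bound hold outright for n ≤ N. Beyond N the recursion multiplies it by at most
  -- K · (4/5) · 5 / (n+1) ≤ 1.
  refine ⟨∑ j ∈ range (N + 1), e j * 4 ^ j, sum_nonneg fun j _ => by have := hpos j; positivity, ?_⟩
  set M := ∑ j ∈ range (N + 1), e j * 4 ^ j with hM
  have hM0 : 0 ≤ M := sum_nonneg fun j _ => by have := hpos j; positivity
  intro n
  change e n ≤ _
  induction n using Nat.strong_induction_on with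
  | _ n ih =>
    by_cases hn : n ≤ N
    · have : e n * 4 ^ n ≤ M :=
        single_le_sum (f := fun j => e j * 4 ^ j) (fun j _ => by have := hpos j; positivity)
          (mem_range.2 (by omega))
      rw [one_div, inv_pow, ← div_eq_mul_inv, le_div_iff₀ (by positivity)]
      exact this
    · obtain ⟨n, rfl⟩ : ∃ m, n = m + 1 := ⟨n - 1, by omega⟩
      have hn1 : (0 : ℝ) < n + 1 := by positivity
      refine le_of_mul_le_mul_right ?_ hn1
      rw [hrec]
      have h1 : ∑ p ∈ antidiagonal n, e p.1 * (1 / 5) ^ (p.2 + 1) ≤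
          ∑ p ∈ antidiagonal n, M * (1 / 4) ^ (n + 1) * (4 / 5) * (4 / 5) ^ p.2 := by
        refine sum_le_sum fun p hp => ?_
        have hp' := mem_antidiagonal.1 hp
        calc e p.1 * (1 / 5) ^ (p.2 + 1) ≤ M * (1 / 4) ^ p.1 * (1 / 5) ^ (p.2 + 1) := by
              gcongr; exact ih p.1 (by omega)
          _ = _ := by
              rw [← hp', div_pow 4 5, div_pow 1 4, div_pow 1 4, div_pow 1 5, pow_succ, pow_succ,
                pow_add]
              simp only [one_pow]
              field_simp
              ring
      have h2 : ∑ p ∈ antidiagonal n, ((4 : ℝ) / 5) ^ p.2 ≤ 5 := by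
        exact (sum_antidiagonal_pow_le (by norm_num) (by norm_num) _).trans (by norm_num)
      rw [← mul_sum] at h1
      have h3 : K * 4 ≤ n + 1 := by
        have : (N : ℝ) ≤ n + 1 := by exact_mod_cast (by omega : N ≤ n + 1)
        linarith
      calc _ ≤ K * (M * (1 / 4) ^ (n + 1) * (4 / 5) * 5) := by
            gcongr
            exact h1.trans (by gcongr)
        _ = M * (1 / 4) ^ (n + 1) * (K * 4) := by ring
        _ ≤ _ := by gcongr

/-- If `L` is dominated by `-log (1 - X / 3) - K log (1 - X / 5)`, then `exp L` has coefficients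
`O(3 ^ (-n))`. -/
lemma exists_abs_coeff_expS_le {K : ℝ} (hK : 0 ≤ K) : ∃ C : ℝ, 0 ≤ C ∧ ∀ L : ℝ⟦X⟧,
    constantCoeff L = 0 →
    (∀ m, |coeff m L| ≤ ((1 / 3) ^ m + K * (1 / 5) ^ m) / m) →
    ∀ n, |coeff n (expS L)| ≤ C * (1 / 3) ^ n := by
  obtain ⟨M, hM0, hM⟩ := coeff_expS_smul_logSeries_le hK
  refine ⟨4 * M, by positivity, fun L hL h n => ?_⟩
  have hc : constantCoeff (K • logSeries (1 / 5)) = 0 := by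
    simp [constantCoeff_logSeries]
  refine (abs_coeff_expS_le (M := logSeries (1 / 3) + K • logSeries (1 / 5)) hL
    (by simp [constantCoeff_logSeries]) (fun m => ?_) n).trans ?_
  · refine (h m).trans (le_of_eq ?_)
    simp only [logSeries, map_add, PowerSeries.coeff_smul, coeff_mk]
    ring
  rw [expS_add (constantCoeff_logSeries _) hc, coeff_mul]
  -- Convolving 3^(-i) with 4^(-j) leaves a geometric series of ratio 3/4, so no power of n is lost.
  calc _ ≤ ∑ p ∈ antidiagonal n, M * (1 / 3) ^ n * (3 / 4) ^ p.2 := by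
        refine sum_le_sum fun p hp => ?_
        rw [coeff_expS_logSeries, ← mem_antidiagonal.1 hp]
        refine (mul_le_mul_of_nonneg_left (hM _) (by positivity)).trans (le_of_eq ?_)
        rw [div_pow 3 4, pow_add, div_pow 1 4, div_pow 1 3 p.2]
        simp only [one_pow]
        field_simp
    _ = M * (1 / 3) ^ n * ∑ p ∈ antidiagonal n, ((3 : ℝ) / 4) ^ p.2 := by rw [mul_sum]
    _ ≤ M * (1 / 3) ^ n * 4 := by
        gcongr
        exact (sum_antidiagonal_pow_le (by norm_num) (by norm_num) _).trans (by norm_num)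
    _ = _ := by ring

/-- Each product costs one factor n + 1, the number of terms in the convolution; these factors
account for the final power of k. -/
lemma abs_coeff_mul_le {F G : ℝ⟦X⟧} {A B r : ℝ} {α β : ℕ} (hr : 0 ≤ r) (hA : 0 ≤ A) (hB : 0 ≤ B)
    (hF : ∀ n, |coeff n F| ≤ A * (n + 1) ^ α * r ^ n)
    (hG : ∀ n, |coeff n G| ≤ B * (n + 1) ^ β * r ^ n) (n : ℕ) :
    |coeff n (F * G)| ≤ A * B * (n + 1) ^ (α + β + 1) * r ^ n := by
  rw [coeff_mul]
  calc _ ≤ ∑ p ∈ antidiagonal n, A * B * (n + 1) ^ (α + β) * r ^ n := by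
        refine (abs_sum_le_sum_abs _ _).trans (sum_le_sum fun p hp => ?_)
        have hp' := mem_antidiagonal.1 hp
        have h1 : (p.1 : ℝ) ≤ n := by exact_mod_cast (by omega : p.1 ≤ n)
        have h2 : (p.2 : ℝ) ≤ n := by exact_mod_cast (by omega : p.2 ≤ n)
        rw [abs_mul]
        calc _ ≤ (A * (p.1 + 1) ^ α * r ^ p.1) * (B * (p.2 + 1) ^ β * r ^ p.2) :=
              mul_le_mul (hF _) (hG _) (abs_nonneg _) (by positivity)
          _ ≤ (A * (n + 1) ^ α * r ^ p.1) * (B * (n + 1) ^ β * r ^ p.2) := by gcongr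
          _ = A * B * (n + 1) ^ (α + β) * r ^ n := by rw [← hp', pow_add, pow_add]; ring
    _ = _ := by
        rw [sum_const, Nat.card_antidiagonal, nsmul_eq_mul]; push_cast; ring

/-! ### Power series depending on a real parameter. -/

section Parameter

variable {s : Set ℝ} {x : ℝ}

lemma hasDerivWithinAt_coeff_mul {F G : ℝ → ℝ⟦X⟧} {F' G' : ℝ⟦X⟧}
    (hF : ∀ n, HasDerivWithinAt (fun t => coeff n (F t)) (coeff n F') s x)
    (hG : ∀ n, HasDerivWithinAt (fun t => coeff n (G t)) (coeff n G') s x) (n : ℕ) :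
    HasDerivWithinAt (fun t => coeff n (F t * G t)) (coeff n (F' * G x + F x * G')) s x := by
  simp only [coeff_mul, map_add, ← sum_add_distrib]
  exact HasDerivWithinAt.fun_sum fun p _ => (hF p.1).mul (hG p.2)

/-- Each coefficient of the exponential is a polynomial in finitely many coefficients of L, so the
chain rule is proved by induction along the recursion, without convergence. -/
lemma hasDerivWithinAt_coeff_expS {L : ℝ → ℝ⟦X⟧} {L' : ℝ⟦X⟧}
    (hL0 : ∀ t, constantCoeff (L t) = 0) (hL0' : constantCoeff L' = 0)
    (hL : ∀ n, HasDerivWithinAt (fun t => coeff n (L t)) (coeff n L') s x) (n : ℕ) :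
    HasDerivWithinAt (fun t => coeff n (expS (L t))) (coeff n (expS (L x) * L')) s x := by
  induction n using Nat.strong_induction_on with
  | _ n ih =>
    cases n with
    | zero =>
      have : coeff 0 (expS (L x) * L') = 0 := by
        rw [coeff_mul]; simp [hL0']
      simp only [coeff_zero_expS (hL0 _), this]
      exact hasDerivWithinAt_const _ _ _
    | succ n =>
      have hn : (n + 1 : ℝ) ≠ 0 := by positivity
      have h1 : ∀ t, coeff (n + 1) (expS (L t)) = (∑ p ∈ antidiagonal n,
          coeff p.1 (expS (L t)) * (coeff (p.2 + 1) (L t) * (p.2 + 1))) / (n + 1) := by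
        intro t
        rw [← succ_mul_coeff_expS (hL0 t), mul_div_cancel_right₀ _ hn]
      simp only [h1]
      -- The X-derivative of E·L' regroups as (E·L')·DL + E·DL', which is the parameter derivative
      -- of the recursion.
      have h2 : coeff (n + 1) (expS (L x) * L') = (∑ p ∈ antidiagonal n,
          (coeff p.1 (expS (L x) * L') * (coeff (p.2 + 1) (L x) * (p.2 + 1)) +
          coeff p.1 (expS (L x)) * (coeff (p.2 + 1) L' * (p.2 + 1)))) / (n + 1) := by
        rw [eq_div_iff hn, ← coeff_derivative, Derivation.leibniz, derivative_expS (hL0 x),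
          sum_add_distrib]
        simp only [← coeff_derivative, ← coeff_mul, smul_eq_mul, ← map_add]
        congr 1; ring
      rw [h2]
      refine HasDerivWithinAt.div_const (HasDerivWithinAt.fun_sum fun p hp => ?_) _
      refine (ih p.1 (by have := mem_antidiagonal.1 hp; omega)).mul ?_
      exact (hL _).mul_const _

end Parameter

/-- The mean value inequality applied twice; the constant M in place of M/2 is harmless. -/
lemma abs_taylor_le {f f' f'' : ℝ → ℝ} {M : ℝ}
    (hf : ∀ x ∈ Set.Icc (0 : ℝ) 1, HasDerivWithinAt f (f' x) (Set.Icc 0 1) x)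
    (hf' : ∀ x ∈ Set.Icc (0 : ℝ) 1, HasDerivWithinAt f' (f'' x) (Set.Icc 0 1) x)
    (hM : ∀ x ∈ Set.Icc (0 : ℝ) 1, |f'' x| ≤ M) {x : ℝ} (hx : x ∈ Set.Icc (0 : ℝ) 1) :
    |f x - f 0 - x * f' 0| ≤ M * x ^ 2 := by
  have h0 : (0 : ℝ) ∈ Set.Icc (0 : ℝ) 1 := by simp
  have hM0 : 0 ≤ M := (abs_nonneg _).trans (hM 0 h0)
  have h1 : ∀ t ∈ Set.Icc (0 : ℝ) 1, |f' t - f' 0| ≤ M * t := by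
    intro t ht
    have := (convex_Icc (0 : ℝ) 1).norm_image_sub_le_of_norm_hasDerivWithin_le hf' hM h0 ht
    simpa [abs_of_nonneg ht.1] using this
  have hsub : Set.Icc 0 x ⊆ Set.Icc (0 : ℝ) 1 := Set.Icc_subset_Icc_right hx.2
  have h2 : ∀ t ∈ Set.Icc (0 : ℝ) x,
      HasDerivWithinAt (fun t => f t - t * f' 0) (f' t - 1 * f' 0) (Set.Icc 0 x) t := fun t ht =>
    ((hf t (hsub ht)).mono hsub).sub ((hasDerivWithinAt_id _ _).mul_const _)
  have h3 : ∀ t ∈ Set.Icc (0 : ℝ) x, ‖f' t - 1 * f' 0‖ ≤ M * x := by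
    intro t ht
    rw [one_mul]
    exact (h1 t (hsub ht)).trans (by have := ht.2; gcongr)
  have := (convex_Icc (0 : ℝ) x).norm_image_sub_le_of_norm_hasDerivWithin_le h2 h3
    (Set.left_mem_Icc.2 hx.1) (Set.right_mem_Icc.2 hx.1)
  simp only [Real.norm_eq_abs, zero_mul, sub_zero, abs_of_nonneg hx.1] at this
  calc |f x - f 0 - x * f' 0| = |f x - x * f' 0 - f 0| := by ring_nf
    _ ≤ M * x * x := this
    _ = M * x ^ 2 := by ring

/-- Second order expansion, with uniform error, of the coefficients of `exp (L t)`. -/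
lemma exists_coeff_expS_taylor {L L' L'' : ℝ → ℝ⟦X⟧} {C : ℝ} (hC : 0 ≤ C)
    (hL0 : ∀ t, constantCoeff (L t) = 0) (hL0' : ∀ t, constantCoeff (L' t) = 0)
    (hL : ∀ n, ∀ x ∈ Set.Icc (0 : ℝ) 1,
      HasDerivWithinAt (fun t => coeff n (L t)) (coeff n (L' x)) (Set.Icc 0 1) x)
    (hL' : ∀ n, ∀ x ∈ Set.Icc (0 : ℝ) 1,
      HasDerivWithinAt (fun t => coeff n (L' t)) (coeff n (L'' x)) (Set.Icc 0 1) x)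
    (hE : ∀ x ∈ Set.Icc (0 : ℝ) 1, ∀ n, |coeff n (expS (L x))| ≤ C * (1 / 3) ^ n)
    (hB' : ∀ x ∈ Set.Icc (0 : ℝ) 1, ∀ n, |coeff n (L' x)| ≤ C * (1 / 3) ^ n)
    (hB'' : ∀ x ∈ Set.Icc (0 : ℝ) 1, ∀ n, |coeff n (L'' x)| ≤ C * (n + 1) * (1 / 3) ^ n)
    {x : ℝ} (hx : x ∈ Set.Icc (0 : ℝ) 1) (n : ℕ) :
    |coeff n (expS (L x)) - coeff n (expS (L 0)) - x * coeff n (expS (L 0) * L' 0)| ≤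
      (C ^ 3 + C ^ 2) * (n + 1) ^ 2 * (1 / 3) ^ n * x ^ 2 := by
  have h1 : ∀ n, ∀ x ∈ Set.Icc (0 : ℝ) 1, HasDerivWithinAt (fun t => coeff n (expS (L t)))
      (coeff n (expS (L x) * L' x)) (Set.Icc 0 1) x := fun n x hx =>
    hasDerivWithinAt_coeff_expS hL0 (hL0' x) (fun n => hL n x hx) n
  -- The second derivative of exp L is exp(L)·L'·L' + exp(L)·L''; both terms have coefficients of
  -- size (n+1)^2 3^(-n).
  refine abs_taylor_le (f := fun t => coeff n (expS (L t)))
    (f' := fun t => coeff n (expS (L t) * L' t))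
    (f'' := fun t => coeff n (expS (L t) * L' t * L' t + expS (L t) * L'' t)) (h1 n)
    (fun x hx => hasDerivWithinAt_coeff_mul (fun n => h1 n x hx) (fun n => hL' n x hx) n)
    (fun x hx => ?_) hx
  have e1 : ∀ n, |coeff n (expS (L x))| ≤ C * (n + 1) ^ 0 * (1 / 3) ^ n := by
    simpa using hE x hx
  have e2 : ∀ n, |coeff n (L' x)| ≤ C * (n + 1) ^ 0 * (1 / 3) ^ n := by
    simpa using hB' x hx
  have e3 : ∀ n, |coeff n (L'' x)| ≤ C * (n + 1) ^ 1 * (1 / 3) ^ n := by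
    simpa using hB'' x hx
  have h3 : (0 : ℝ) ≤ 1 / 3 := by norm_num
  have f1 := abs_coeff_mul_le h3 (by positivity) hC (abs_coeff_mul_le h3 hC hC e1 e2) e2 n
  have f2 := abs_coeff_mul_le h3 hC hC e1 e3 n
  rw [map_add]
  refine (abs_add_le _ _).trans ((add_le_add f1 f2).trans (le_of_eq ?_))
  ring

/-! ### Evaluation of power series inside the disc of radius 3. -/

/-- The value at `x` of a power series. -/
noncomputable def ev (F : ℝ⟦X⟧) (x : ℝ) : ℝ := ∑' n, coeff n F * x ^ n

/-- The coefficients are bounded by a polynomial multiple of `3 ^ (-n)`. -/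
def Tame (F : ℝ⟦X⟧) : Prop :=
  ∃ (C : ℝ) (α : ℕ), 0 ≤ C ∧ ∀ n, |coeff n F| ≤ C * (n + 1) ^ α * (1 / 3) ^ n

lemma Tame.mul {F G : ℝ⟦X⟧} (hF : Tame F) (hG : Tame G) : Tame (F * G) := by
  obtain ⟨A, α, hA, hF⟩ := hF
  obtain ⟨B, β, hB, hG⟩ := hG
  exact ⟨A * B, _, by positivity, abs_coeff_mul_le (by norm_num) hA hB hF hG⟩

lemma Tame.derivative {F : ℝ⟦X⟧} (hF : Tame F) : Tame (d⁄dX ℝ F) := by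
  obtain ⟨A, α, hA, hF⟩ := hF
  refine ⟨A * 2 ^ α, α + 1, by positivity, fun n => ?_⟩
  rw [coeff_derivative, abs_mul, abs_of_nonneg (by positivity : (0 : ℝ) ≤ n + 1)]
  have h : ((n + 1 : ℕ) + 1 : ℝ) ≤ 2 * (n + 1) := by push_cast; linarith [n.cast_nonneg (α := ℝ)]
  calc _ ≤ A * ((n + 1 : ℕ) + 1) ^ α * (1 / 3) ^ (n + 1) * (n + 1) := by gcongr; exact hF _
    _ ≤ A * (2 * (n + 1)) ^ α * (1 / 3) ^ n * (n + 1) := by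
        gcongr A * ?_ * ?_ * _
        · gcongr
        · exact pow_le_pow_of_le_one (by norm_num) (by norm_num) (by omega)
    _ = _ := by rw [mul_pow]; ring

lemma summable_succ_pow_mul_geometric (α : ℕ) {r : ℝ} (h0 : 0 ≤ r) (h1 : r < 1) :
    Summable fun n : ℕ => ((n : ℝ) + 1) ^ α * r ^ n := by
  have h : Summable fun n : ℕ => (n : ℝ) ^ α * r ^ n :=
    summable_pow_mul_geometric_of_norm_lt_one α (by rwa [Real.norm_of_nonneg h0])
  have h2 : Summable fun n : ℕ => r ^ n := summable_geometric_of_lt_one h0 h1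
  refine ((h.add h2).mul_left (2 ^ α)).of_nonneg_of_le (fun n => by positivity) fun n => ?_
  suffices h : ((n : ℝ) + 1) ^ α ≤ 2 ^ α * (n ^ α + 1) by
    calc _ ≤ 2 ^ α * ((n : ℝ) ^ α + 1) * r ^ n := by gcongr
      _ = _ := by ring
  rcases Nat.eq_zero_or_pos n with rfl | hn
  · have h1 : (1 : ℝ) ≤ 2 ^ α := one_le_pow₀ (by norm_num)
    have h2 : (0 : ℝ) ≤ (0 : ℝ) ^ α := by positivity
    simp only [Nat.cast_zero, zero_add, one_pow]
    nlinarith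
  · have : (1 : ℝ) ≤ n := by exact_mod_cast hn
    calc ((n : ℝ) + 1) ^ α ≤ (2 * n) ^ α := by gcongr; linarith
      _ = 2 ^ α * n ^ α := mul_pow _ _ _
      _ ≤ _ := by gcongr; linarith

lemma Tame.summable_abs {F : ℝ⟦X⟧} (hF : Tame F) {x : ℝ} (hx : |x| < 3) :
    Summable fun n => |coeff n F * x ^ n| := by
  obtain ⟨A, α, hA, hF⟩ := hF
  refine ((summable_succ_pow_mul_geometric α (r := |x| / 3) (by positivity)
    (by rwa [div_lt_one (by norm_num)])).mul_left A).of_nonneg_of_le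
    (fun n => abs_nonneg _) fun n => ?_
  rw [abs_mul, abs_pow]
  refine (mul_le_mul_of_nonneg_right (hF n) (by positivity)).trans (le_of_eq ?_)
  rw [div_pow, div_pow, one_pow]; ring

lemma Tame.summable {F : ℝ⟦X⟧} (hF : Tame F) {x : ℝ} (hx : |x| < 3) :
    Summable fun n => coeff n F * x ^ n := (hF.summable_abs hx).of_abs

lemma Tame.ev_mul {F G : ℝ⟦X⟧} (hF : Tame F) (hG : Tame G) {x : ℝ} (hx : |x| < 3) :
    ev (F * G) x = ev F x * ev G x := by
  have h1 : Summable fun n => ‖coeff n F * x ^ n‖ := hF.summable_abs hx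
  have h2 : Summable fun n => ‖coeff n G * x ^ n‖ := hG.summable_abs hx
  have key := tsum_mul_tsum_eq_tsum_sum_antidiagonal_of_summable_norm h1 h2
  unfold ev
  rw [key]
  refine tsum_congr fun n => ?_
  rw [coeff_mul, sum_mul]
  refine sum_congr rfl fun p hp => ?_
  rw [← mem_antidiagonal.1 hp, pow_add]; ring

lemma Tame.hasDerivAt_ev {F : ℝ⟦X⟧} (hF : Tame F) {x : ℝ} (hx : |x| < 3) :
    HasDerivAt (ev F) (ev (d⁄dX ℝ F) x) x := by
  obtain ⟨r, hxr, hr3⟩ := exists_between hx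
  have hr0 : 0 ≤ r := (abs_nonneg x).trans hxr.le
  have hD := hF.derivative.summable_abs (x := r) (by rwa [abs_of_nonneg hr0])
  have hu : Summable fun n => |coeff n F * (n * r ^ (n - 1))| := by
    rw [← summable_nat_add_iff 1]
    refine hD.congr fun n => ?_
    rw [coeff_derivative, Nat.add_sub_cancel]; push_cast; ring_nf
  have h := hasDerivAt_tsum_of_isPreconnected (t := Set.Ioo (-r) r) (y := x) (y₀ := x)
    (g := fun n x => coeff n F * x ^ n) (g' := fun n x => coeff n F * (n * x ^ (n - 1)))
    hu isOpen_Ioo isPreconnected_Ioo (fun n y _ => (hasDerivAt_pow n y).const_mul _)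
    (fun n y hy => by
      rw [Real.norm_eq_abs, abs_mul, abs_mul, abs_mul, abs_mul, abs_pow, abs_pow]
      have : |y| ≤ |r| := by rw [abs_of_nonneg hr0]; exact (abs_lt.2 hy).le
      gcongr) (abs_lt.1 hxr) (hF.summable hx) (abs_lt.1 hxr)
  have hs : Summable fun n => coeff n F * (n * x ^ (n - 1)) := by
    rw [← summable_nat_add_iff 1]
    refine (hF.derivative.summable hx).congr fun n => ?_
    rw [coeff_derivative, Nat.add_sub_cancel]; push_cast; ring_nf
  suffices he : ∑' n, coeff n F * (n * x ^ (n - 1)) = ev (d⁄dX ℝ F) x by rw [← he]; exact h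
  rw [hs.tsum_eq_zero_add, ev]
  simp only [Nat.cast_zero, zero_mul, mul_zero, zero_add]
  refine tsum_congr fun n => ?_
  rw [coeff_derivative, Nat.add_sub_cancel]; push_cast; ring_nf

lemma ev_zero (F : ℝ⟦X⟧) : ev F 0 = coeff 0 F := by
  rw [ev, tsum_eq_single 0 (fun n hn => by simp [hn])]; simp

/-- Evaluating a formal exponential inside the disc of convergence. -/
lemma ev_expS {L : ℝ⟦X⟧} (hL0 : constantCoeff L = 0) (hE : Tame (expS L)) (hL : Tame L) {x : ℝ}
    (hx : |x| < 3) : ev (expS L) x = Real.exp (ev L x) := by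
  -- The quotient of the two sides has derivative zero, and it equals 1 at the origin.
  have h : ∀ y ∈ Set.Ioo (-3 : ℝ) 3,
      HasDerivAt (fun y => ev (expS L) y * Real.exp (-ev L y)) 0 y := by
    intro y hy
    have hy := abs_lt.2 hy
    convert! (hE.hasDerivAt_ev hy).mul (hL.hasDerivAt_ev hy).neg.exp using 1
    rw [derivative_expS hL0, hE.ev_mul hL.derivative hy]
    ring
  have h1 := (isOpen_Ioo (a := (-3 : ℝ)) (b := 3)).is_const_of_deriv_eq_zero isPreconnected_Ioo
    (fun y hy => (h y hy).differentiableAt.differentiableWithinAt) (fun y hy => (h y hy).deriv)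
    (abs_lt.1 hx) (by norm_num : (0 : ℝ) ∈ Set.Ioo (-3 : ℝ) 3)
  simp only [ev_zero, coeff_zero_expS hL0] at h1
  rw [coeff_zero_eq_constantCoeff_apply, hL0, Real.exp_neg, neg_zero, Real.exp_zero, mul_one,
    ← div_eq_mul_inv, div_eq_one_iff_eq (Real.exp_ne_zero _)] at h1
  exact h1

/-! ### Prime sums and their derivatives. -/

/-- The sum `∑ (log p) ^ i / p ^ w` over the primes `p > y`. -/
noncomputable def primeSum (y i : ℕ) (w : ℝ) : ℝ :=
  ∑' p : primesAbove y, Real.log (p : ℕ) ^ i * ((p : ℕ) : ℝ) ^ (-w)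

lemma three_le_of_mem_primesAbove (hy : 2 ≤ y) (p : primesAbove y) : (3 : ℝ) ≤ (p : ℕ) := by
  have := p.2.2
  exact_mod_cast (by omega : 3 ≤ (p : ℕ))

lemma log_pos_of_mem_primesAbove (p : primesAbove y) : 0 < Real.log (p : ℕ) :=
  Real.log_pos (by exact_mod_cast p.2.1.one_lt)

lemma pos_of_mem_primesAbove (p : primesAbove y) : (0 : ℝ) < (p : ℕ) := by
  exact_mod_cast p.2.1.pos

lemma summable_log_pow_mul_rpow (i : ℕ) {w : ℝ} (hw : 1 < w) :
    Summable fun n : ℕ => Real.log n ^ i * (n : ℝ) ^ (-w) := by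
  -- Half of the excess w - 1 pays for the logarithms: iδ ≤ (w-1)/2. Using i + 1 keeps δ defined
  -- when i = 0.
  set δ : ℝ := (w - 1) / (2 * (i + 1)) with hδ
  have hδ0 : 0 < δ := div_pos (by linarith) (by positivity)
  have hs : Summable fun n : ℕ => (1 / δ) ^ i * (n : ℝ) ^ (-((1 + w) / 2)) :=
    (Real.summable_nat_rpow.2 (by linarith)).mul_left _
  refine hs.of_nonneg_of_le
    (fun n => mul_nonneg (pow_nonneg (Real.log_natCast_nonneg n) _) (by positivity)) fun n => ?_
  rcases Nat.eq_zero_or_pos n with rfl | hn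
  · have h1 : (0 : ℝ) ^ (-w) = 0 := Real.zero_rpow (by linarith)
    simp only [Nat.cast_zero, h1, mul_zero]
    positivity
  have hn1 : (1 : ℝ) ≤ n := by exact_mod_cast hn
  have h1 : Real.log n ^ i ≤ ((n : ℝ) ^ δ / δ) ^ i := by
    gcongr
    exact Real.log_le_rpow_div (by positivity) hδ0
  have h2 : ((n : ℝ) ^ δ) ^ i ≤ (n : ℝ) ^ ((w - 1) / 2) := by
    rw [← Real.rpow_natCast, ← Real.rpow_mul (by positivity)]
    refine Real.rpow_le_rpow_of_exponent_le hn1 ?_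
    rw [hδ, div_mul_eq_mul_div, div_le_div_iff₀ (by positivity) (by norm_num)]
    nlinarith
  calc Real.log n ^ i * (n : ℝ) ^ (-w) ≤ ((n : ℝ) ^ δ / δ) ^ i * (n : ℝ) ^ (-w) := by gcongr
    _ = (1 / δ) ^ i * (((n : ℝ) ^ δ) ^ i * (n : ℝ) ^ (-w)) := by
        rw [div_pow _ δ, div_pow 1 δ, one_pow]; ring
    _ ≤ (1 / δ) ^ i * ((n : ℝ) ^ ((w - 1) / 2) * (n : ℝ) ^ (-w)) := by gcongr
    _ = _ := by rw [← Real.rpow_add (by positivity)]; congr 2; ring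

lemma summable_primeSum (i : ℕ) {w : ℝ} (hw : 1 < w) :
    Summable fun p : primesAbove y => Real.log (p : ℕ) ^ i * ((p : ℕ) : ℝ) ^ (-w) :=
  (summable_log_pow_mul_rpow i hw).subtype _

lemma primeSum_nonneg (i : ℕ) (w : ℝ) : 0 ≤ primeSum y i w :=
  tsum_nonneg fun p => by have := log_pos_of_mem_primesAbove p; positivity

lemma hasDerivAt_primeSum (i : ℕ) {w : ℝ} (hw : 1 < w) :
    HasDerivAt (primeSum y i) (-primeSum y (i + 1) w) w := by
  obtain ⟨c, h1c, hcw⟩ := exists_between hw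
  have h := hasDerivAt_tsum_of_isPreconnected (t := Set.Ioi c) (y := w) (y₀ := w)
    (g := fun (p : primesAbove y) w => Real.log (p : ℕ) ^ i * ((p : ℕ) : ℝ) ^ (-w))
    (g' := fun (p : primesAbove y) w => -(Real.log (p : ℕ) ^ (i + 1) * ((p : ℕ) : ℝ) ^ (-w)))
    (u := fun p : primesAbove y => Real.log (p : ℕ) ^ (i + 1) * ((p : ℕ) : ℝ) ^ (-c))
    (summable_primeSum (i + 1) h1c) isOpen_Ioi isPreconnected_Ioi (fun p v _ => by
      have hp := pos_of_mem_primesAbove p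
      convert! ((hasDerivAt_neg v).const_rpow hp).const_mul (Real.log (p : ℕ) ^ i) using 1
      ring) (fun p v hv => by
      have hp := log_pos_of_mem_primesAbove p
      have hp1 : (1 : ℝ) ≤ (p : ℕ) := by exact_mod_cast p.2.1.one_lt.le
      rw [norm_neg, Real.norm_of_nonneg (by positivity)]
      have hv : c < v := hv
      gcongr) hcw (summable_primeSum i hw) hcw
  rw [tsum_neg] at h
  exact h

/-- Every prime above y ≥ 2 is at least 3; this is the source of the radius 3. -/
lemma primeSum_add_le (hy : 2 ≤ y) (i : ℕ) {u v : ℝ} (hu : 1 < u) (hv : 0 ≤ v) :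
    primeSum y i (u + v) ≤ 3 ^ (-v) * primeSum y i u := by
  rw [primeSum, primeSum, ← tsum_mul_left]
  refine (summable_primeSum i (by linarith)).tsum_le_tsum (fun p => ?_)
    ((summable_primeSum i hu).mul_left _)
  have hp := log_pos_of_mem_primesAbove p
  have hp0 := pos_of_mem_primesAbove p
  have h3 : ((p : ℕ) : ℝ) ^ (-v) ≤ 3 ^ (-v) :=
    Real.rpow_le_rpow_of_nonpos (by norm_num) (three_le_of_mem_primesAbove hy p) (by linarith)
  rw [neg_add, Real.rpow_add hp0]
  calc _ = ((p : ℕ) : ℝ) ^ (-v) * (Real.log (p : ℕ) ^ i * ((p : ℕ) : ℝ) ^ (-u)) := by ring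
    _ ≤ _ := by gcongr

/-- For `m ≥ 2` and `w ≥ 1`, the prime sum at `m w` is `O(3 ^ (-m))`. -/
lemma primeSum_mul_le (hy : 2 ≤ y) (i m : ℕ) {x : ℝ} (hx : 0 ≤ x) :
    primeSum y i ((m + 2) * (1 + x)) ≤ (1 / 3) ^ m * primeSum y i 2 := by
  have h := primeSum_add_le hy i (u := 2) (v := (m + 2) * (1 + x) - 2) (by norm_num) (by
    nlinarith [mul_nonneg (by positivity : (0 : ℝ) ≤ m + 2) hx, m.cast_nonneg (α := ℝ)])
  rw [add_sub_cancel] at h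
  refine h.trans (mul_le_mul_of_nonneg_right ?_ (primeSum_nonneg _ _))
  rw [one_div, inv_pow, ← Real.rpow_natCast, ← Real.rpow_neg (by norm_num)]
  refine Real.rpow_le_rpow_of_exponent_le (by norm_num) ?_
  nlinarith [mul_nonneg (by positivity : (0 : ℝ) ≤ m + 2) hx]

/-- A weaker decay, valid slightly to the left of 0, so that series can be differentiated on an open
interval containing x = 0. -/
lemma primeSum_mul_le_of_gt (hy : 2 ≤ y) (i m : ℕ) {x : ℝ} (hx : -(1 / 4) < x) :
    primeSum y i ((m + 2) * (1 + x)) ≤ ((3 : ℝ) ^ (-(3 / 4 : ℝ))) ^ m * primeSum y i (3 / 2) := by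
  have h := primeSum_add_le hy i (u := 3 / 2) (v := (m + 2) * (1 + x) - 3 / 2) (by norm_num) (by
    nlinarith [mul_nonneg (by positivity : (0 : ℝ) ≤ m + 2) (by linarith : 0 ≤ x + 1 / 4),
      m.cast_nonneg (α := ℝ)])
  rw [add_sub_cancel] at h
  refine h.trans (mul_le_mul_of_nonneg_right ?_ (primeSum_nonneg _ _))
  rw [← Real.rpow_natCast, ← Real.rpow_mul (by norm_num)]
  refine Real.rpow_le_rpow_of_exponent_le (by norm_num) ?_
  nlinarith [mul_nonneg (by positivity : (0 : ℝ) ≤ m + 2) (by linarith : 0 ≤ x + 1 / 4)]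

/-- The prime sum at `m w` with the contribution of `3` isolated. -/
lemma primeSum_zero_le (hy : 2 ≤ y) (m : ℕ) {x : ℝ} (hx : 0 ≤ x) :
    primeSum y 0 ((m + 2) * (1 + x)) ≤
      (1 / 3) ^ (m + 2) + 25 * primeSum y 0 2 * (1 / 5) ^ (m + 2) := by
  classical
  have hm : (1 : ℝ) < (m + 2) * (1 + x) := by
    nlinarith [mul_nonneg (by positivity : (0 : ℝ) ≤ m + 2) hx, m.cast_nonneg (α := ℝ)]
  -- The prime 3 must enter with coefficient exactly 1: a larger coefficient a would produce (1 -
  -- X/3)^(-a) and lose a power of n.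
  set g : primesAbove y → ℝ := fun p => if (p : ℕ) = 3 then (1 / 3) ^ (m + 2) else 0 with hg
  have hgs : Summable g ∧ ∑' p, g p ≤ (1 / 3) ^ (m + 2) := by
    by_cases h3 : 3 ∈ primesAbove y
    · have h0 : ∀ p : primesAbove y, p ≠ ⟨3, h3⟩ → g p = 0 := by
        intro p hp
        exact if_neg fun h => hp (Subtype.ext h)
      refine ⟨summable_of_ne_finset_zero (s := {⟨3, h3⟩}) fun p hp => h0 p (by simpa using hp), ?_⟩
      rw [tsum_eq_single _ h0]
      simp [hg]
    · have h0 : g = 0 := by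
        ext p
        exact if_neg fun h : (p : ℕ) = 3 => h3 (h ▸ p.2)
      rw [h0]
      exact ⟨summable_zero, by simp only [Pi.zero_apply, tsum_zero]; positivity⟩
  have hs2 := (summable_primeSum (y := y) 0 (w := 2) (by norm_num)).mul_right
    (25 * (1 / 5) ^ (m + 2) : ℝ)
  calc primeSum y 0 ((m + 2) * (1 + x)) ≤ ∑' p : primesAbove y, (g p +
        Real.log (p : ℕ) ^ 0 * ((p : ℕ) : ℝ) ^ (-(2 : ℝ)) * (25 * (1 / 5) ^ (m + 2))) := by
        refine (summable_primeSum 0 hm).tsum_le_tsum (fun p => ?_) (hgs.1.add hs2)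
        have hp0 := pos_of_mem_primesAbove p
        have hp1 : (1 : ℝ) ≤ (p : ℕ) := by exact_mod_cast p.2.1.one_lt.le
        have h1 : ((p : ℕ) : ℝ) ^ (-((m + 2) * (1 + x))) ≤ (1 / ((p : ℕ) : ℝ)) ^ (m + 2) := by
          rw [one_div, inv_pow, ← Real.rpow_natCast, ← Real.rpow_neg hp0.le]
          refine Real.rpow_le_rpow_of_exponent_le hp1 ?_
          push_cast
          nlinarith [mul_nonneg (by positivity : (0 : ℝ) ≤ m + 2) hx]
        have h2 : ((p : ℕ) : ℝ) ^ (-(2 : ℝ)) = (1 / ((p : ℕ) : ℝ)) ^ 2 := by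
          rw [one_div, inv_pow, ← Real.rpow_natCast, ← Real.rpow_neg hp0.le]
          norm_num
        rw [pow_zero, one_mul, one_mul, h2]
        refine h1.trans ?_
        by_cases h3 : (p : ℕ) = 3
        · simp only [hg, h3, if_true]
          push_cast
          linarith [show (0 : ℝ) ≤ (1 / 3) ^ 2 * (25 * (1 / 5) ^ (m + 2)) by positivity]
        · have h5 : 5 ≤ (p : ℕ) := by
            have h4 : (p : ℕ) ≠ 4 := fun h => absurd (h ▸ p.2.1) (by norm_num)
            have := p.2.2
            omega
          have h5' : (5 : ℝ) ≤ (p : ℕ) := by exact_mod_cast h5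
          simp only [hg, h3, if_false, zero_add]
          rw [pow_add _ m 2, pow_add _ m 2]
          have : (1 / ((p : ℕ) : ℝ)) ^ m ≤ (1 / 5) ^ m := by gcongr
          -- Two powers of p are kept for summability and the others bounded by 1/5; the factor 25
          -- restores the exponent m + 2.
          calc _ ≤ (1 / 5) ^ m * (1 / ((p : ℕ) : ℝ)) ^ 2 := by gcongr
            _ = _ := by ring
    _ = ∑' p, g p + 25 * primeSum y 0 2 * (1 / 5) ^ (m + 2) := by
        rw [hgs.1.tsum_add hs2, tsum_mul_right, primeSum]; ring
    _ ≤ _ := by linarith [hgs.2]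

lemma hasDerivAt_primeSum_mul (i m : ℕ) {x : ℝ} (hx : -(1 / 4) < x) :
    HasDerivAt (fun x => primeSum y i ((m + 2) * (1 + x)))
      (-((m + 2) * primeSum y (i + 1) ((m + 2) * (1 + x)))) x := by
  have hm : (1 : ℝ) < (m + 2) * (1 + x) := by
    nlinarith [mul_nonneg (by positivity : (0 : ℝ) ≤ m + 2) (by linarith : 0 ≤ x + 1 / 4),
      m.cast_nonneg (α := ℝ)]
  have h := (hasDerivAt_primeSum (y := y) i hm).comp x
    (((hasDerivAt_id x).const_add 1).const_mul (m + 2 : ℝ))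
  convert! h using 1
  ring

/-- The sum `∑ m ^ (i - 1) (log p) ^ i p ^ (-m (1 + x))` over `m ≥ 2` and the primes `p > y`. -/
noncomputable def higherSum (y i : ℕ) (x : ℝ) : ℝ :=
  ∑' m : ℕ, ((m : ℝ) + 2) ^ i / (m + 2) * primeSum y i ((m + 2) * (1 + x))

lemma summable_higherSum_bound (i : ℕ) {r : ℝ} (h0 : 0 ≤ r) (h1 : r < 1) (c : ℝ) :
    Summable fun m : ℕ => ((m : ℝ) + 2) ^ i / (m + 2) * (r ^ m * c) := by
  have h := ((summable_succ_pow_mul_geometric i h0 h1).mul_left (2 ^ i)).mul_right |c|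
  refine Summable.of_norm_bounded h fun m => ?_
  rw [norm_mul, norm_mul, Real.norm_of_nonneg (by positivity),
    Real.norm_of_nonneg (by positivity), Real.norm_eq_abs, ← mul_assoc, ← mul_assoc]
  gcongr
  calc ((m : ℝ) + 2) ^ i / (m + 2) ≤ ((m : ℝ) + 2) ^ i :=
        div_le_self (by positivity) (by linarith [m.cast_nonneg (α := ℝ)])
    _ ≤ (2 * (m + 1)) ^ i := by gcongr; linarith [m.cast_nonneg (α := ℝ)]
    _ = _ := mul_pow _ _ _

lemma summable_higherSum (hy : 2 ≤ y) (i : ℕ) {x : ℝ} (hx : -(1 / 4) < x) :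
    Summable fun m : ℕ => ((m : ℝ) + 2) ^ i / (m + 2) * primeSum y i ((m + 2) * (1 + x)) := by
  refine (summable_higherSum_bound i (r := (3 : ℝ) ^ (-(3 / 4 : ℝ))) (by positivity)
    (Real.rpow_lt_one_of_one_lt_of_neg (by norm_num) (by norm_num))
    (primeSum y i (3 / 2))).of_nonneg_of_le
    (fun m => mul_nonneg (by positivity) (primeSum_nonneg _ _)) fun m => ?_
  gcongr
  exact primeSum_mul_le_of_gt hy i m hx

/-- Each differentiation brings down -(m+2) log p, which is exactly the step from i to i + 1. -/
lemma hasDerivAt_higherSum (hy : 2 ≤ y) (i : ℕ) {x : ℝ} (hx : -(1 / 4) < x) :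
    HasDerivAt (higherSum y i) (-higherSum y (i + 1) x) x := by
  have h := hasDerivAt_tsum_of_isPreconnected (t := Set.Ioi (-(1 / 4) : ℝ)) (y := x) (y₀ := x)
    (g := fun (m : ℕ) x => ((m : ℝ) + 2) ^ i / (m + 2) * primeSum y i ((m + 2) * (1 + x)))
    (g' := fun (m : ℕ) x =>
      -(((m : ℝ) + 2) ^ (i + 1) / (m + 2) * primeSum y (i + 1) ((m + 2) * (1 + x))))
    (summable_higherSum_bound (i + 1) (r := (3 : ℝ) ^ (-(3 / 4 : ℝ))) (by positivity)
      (Real.rpow_lt_one_of_one_lt_of_neg (by norm_num) (by norm_num))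
      (primeSum y (i + 1) (3 / 2))) isOpen_Ioi isPreconnected_Ioi (fun m v hv => by
      convert! (hasDerivAt_primeSum_mul (y := y) i m hv).const_mul (((m : ℝ) + 2) ^ i / (m + 2))
        using 1
      ring) (fun m v hv => by
      rw [norm_neg, Real.norm_of_nonneg (mul_nonneg (by positivity) (primeSum_nonneg _ _))]
      gcongr
      exact primeSum_mul_le_of_gt hy _ m hv) hx (summable_higherSum hy i hx) hx
  rw [tsum_neg] at h
  exact h

/-! ### Rough almost primes and Newton's identity. -/

/-- The sum of `n ^ (-s)` over the `n` with `Ω n = k` free of prime factors `≤ y`. -/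
noncomputable def roughSum (k y : ℕ) (s : ℝ) : ℝ :=
  ∑' n : roughAlmostPrimes k y, ((n : ℕ) : ℝ) ^ (-s)

lemma summable_roughSum (k : ℕ) {s : ℝ} (hs : 1 < s) :
    Summable fun n : roughAlmostPrimes k y => ((n : ℕ) : ℝ) ^ (-s) :=
  (Real.summable_nat_rpow.2 (by linarith)).subtype _

lemma roughSum_zero (s : ℝ) : roughSum 0 y s = 1 := by
  have h1 : 1 ∈ roughAlmostPrimes 0 y :=
    ⟨one_ne_zero, by simp, fun p hp h => absurd (Nat.dvd_one.1 h) hp.ne_one⟩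
  have h2 : ∀ n : roughAlmostPrimes 0 y, n = ⟨1, h1⟩ := by
    intro n
    have hn := n.2.2.1
    rcases ArithmeticFunction.cardFactors_eq_zero_iff_eq_zero_or_one.1 hn with h | h
    · exact absurd h n.2.1
    · exact Subtype.ext h
  rw [roughSum, tsum_eq_single ⟨1, h1⟩ fun n hn => absurd (h2 n) hn]
  simp

lemma mul_pow_mem_roughAlmostPrimes {i j k p n : ℕ} (hk : i + j = k) (hp : p ∈ primesAbove y)
    (hn : n ∈ roughAlmostPrimes i y) : n * p ^ (j + 1) ∈ roughAlmostPrimes (k + 1) y := by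
  have hpj : p ^ (j + 1) ≠ 0 := pow_ne_zero _ hp.1.ne_zero
  refine ⟨mul_ne_zero hn.1 hpj, ?_, fun q hq hd => ?_⟩
  · rw [ArithmeticFunction.cardFactors_mul hn.1 hpj, hn.2.1,
      ArithmeticFunction.cardFactors_apply_prime_pow hp.1]
    omega
  · rcases (hq.dvd_mul).1 hd with h | h
    · exact hn.2.2 q hq h
    · rw [(Nat.prime_dvd_prime_iff_eq hq hp.1).1 (hq.dvd_of_dvd_pow h)]
      exact hp.2

lemma mem_roughAlmostPrimes_of_mul_pow {i j k p n : ℕ} (hk : i + j = k) (hp : p ∈ primesAbove y)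
    (hn : n * p ^ (j + 1) ∈ roughAlmostPrimes (k + 1) y) : n ∈ roughAlmostPrimes i y := by
  have hpj : p ^ (j + 1) ≠ 0 := pow_ne_zero _ hp.1.ne_zero
  have hn0 : n ≠ 0 := left_ne_zero_of_mul hn.1
  refine ⟨hn0, ?_, fun q hq hd => hn.2.2 q hq (hd.mul_right _)⟩
  have := hn.2.1
  rw [ArithmeticFunction.cardFactors_mul hn0 hpj,
      ArithmeticFunction.cardFactors_apply_prime_pow hp.1] at this
  omega

-- Multiplication by p^(j+1) is a bijection from the rough n with Ω(n) = i onto the multiples of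
-- p^(j+1) among those with Ω(n) = k + 1.
open Classical in
lemma roughSum_mul_rpow {i j k p : ℕ} (hk : i + j = k) (hp : p ∈ primesAbove y) (s : ℝ) :
    roughSum i y s * (p : ℝ) ^ (-((j + 1) * s)) =
      ∑' n : roughAlmostPrimes (k + 1) y,
        if p ^ (j + 1) ∣ (n : ℕ) then ((n : ℕ) : ℝ) ^ (-s) else 0 := by
  have hpj : p ^ (j + 1) ≠ 0 := pow_ne_zero _ hp.1.ne_zero
  set g : roughAlmostPrimes i y → roughAlmostPrimes (k + 1) y :=
    fun n => ⟨n * p ^ (j + 1), mul_pow_mem_roughAlmostPrimes hk hp n.2⟩ with hg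
  have hinj : Function.Injective g := by
    intro a b h
    exact Subtype.ext (mul_right_cancel₀ hpj (congrArg Subtype.val h))
  rw [← hinj.tsum_eq, roughSum, ← tsum_mul_right]
  · refine tsum_congr fun n => ?_
    rw [if_pos (Dvd.intro_left _ rfl)]
    simp only [hg]
    push_cast
    rw [Real.mul_rpow (by positivity) (by positivity), ← Real.rpow_natCast (p : ℝ),
      ← Real.rpow_mul (by positivity)]
    push_cast
    ring_nf
  · intro n hn
    have hd : p ^ (j + 1) ∣ (n : ℕ) := by
      by_contra h
      exact hn (if_neg h)
    obtain ⟨c, hc⟩ := hd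
    rw [mul_comm] at hc
    exact ⟨⟨c, mem_roughAlmostPrimes_of_mul_pow hk hp (hc ▸ n.2)⟩, Subtype.ext hc.symm⟩

-- The number of pairs (p, j) with p^(j+1) dividing n is ∑ v_p(n) = Ω(n).
open Classical in
lemma sum_tsum_ite_pow_dvd {k : ℕ} (n : roughAlmostPrimes (k + 1) y) (c : ℝ) :
    ∑ j ∈ range (k + 1), ∑' p : primesAbove y, (if (p : ℕ) ^ (j + 1) ∣ (n : ℕ) then c else 0) =
      (k + 1) * c := by
  have hn0 : (n : ℕ) ≠ 0 := n.2.1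
  have h1 : ∀ j, ∑' p : primesAbove y, (if (p : ℕ) ^ (j + 1) ∣ (n : ℕ) then c else 0) =
      ∑ p ∈ (n : ℕ).primeFactors, if p ^ (j + 1) ∣ (n : ℕ) then c else 0 := by
    intro j
    rw [tsum_subtype (primesAbove y) fun p => if p ^ (j + 1) ∣ (n : ℕ) then c else 0,
      tsum_eq_sum (s := (n : ℕ).primeFactors)]
    · refine sum_congr rfl fun p hp => Set.indicator_of_mem ?_ _
      have hp := Nat.mem_primeFactors.1 hp
      exact ⟨hp.1, n.2.2.2 p hp.1 hp.2.1⟩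
    · intro p hp
      by_cases hpy : p ∈ primesAbove y
      · rw [Set.indicator_of_mem hpy, if_neg]
        intro hd
        exact hp (Nat.mem_primeFactors.2 ⟨hpy.1, (dvd_pow_self p (by omega)).trans hd, hn0⟩)
      · exact Set.indicator_of_notMem hpy _
  simp only [h1]
  rw [sum_comm]
  have hΩ : ∑ p ∈ (n : ℕ).primeFactors, (n : ℕ).factorization p = k + 1 := by
    refine Eq.trans ?_ n.2.2.1
    rw [ArithmeticFunction.cardFactors_eq_sum_factorization]
    rfl
  have h2 : ∀ p ∈ (n : ℕ).primeFactors,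
      ∑ j ∈ range (k + 1), (if p ^ (j + 1) ∣ (n : ℕ) then c else 0) =
        (n : ℕ).factorization p * c := by
    intro p hp
    have hpp := Nat.prime_of_mem_primeFactors hp
    have hle : (n : ℕ).factorization p ≤ k + 1 :=
      (single_le_sum (f := fun p => (n : ℕ).factorization p) (fun _ _ => Nat.zero_le _) hp).trans
        hΩ.le
    rw [← sum_filter, sum_const, nsmul_eq_mul]
    congr 2
    have : {j ∈ range (k + 1) | p ^ (j + 1) ∣ (n : ℕ)} = range ((n : ℕ).factorization p) := by
      ext j
      rw [mem_filter, mem_range, mem_range, hpp.pow_dvd_iff_le_factorization hn0]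
      omega
    rw [this, card_range]
  rw [sum_congr rfl h2, ← sum_mul, ← Nat.cast_sum, hΩ]
  push_cast; ring

open Classical in
/-- Newton's identity. -/
lemma succ_mul_roughSum (k : ℕ) {s : ℝ} (hs : 1 < s) :
    roughSum (k + 1) y s * (k + 1) =
      ∑ q ∈ antidiagonal k, roughSum q.1 y s * primeSum y 0 ((q.2 + 1) * s) := by
  -- Double counting of triples (j, p, n) with p^(j+1) ∣ n and weight n^(-s): summing over n first
  -- gives the right side, over (j, p) first counts each n exactly Ω(n) = k + 1 times.
  set F : ℕ → primesAbove y → roughAlmostPrimes (k + 1) y → ℝ :=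
    fun j p n => if (p : ℕ) ^ (j + 1) ∣ (n : ℕ) then ((n : ℕ) : ℝ) ^ (-s) else 0 with hF
  have hF0 : ∀ j p n, 0 ≤ F j p n := fun j p n => by simp only [hF]; positivity
  have hprod : ∀ j ≤ k, Summable (Function.uncurry (F j)) := by
    intro j hj
    refine (summable_prod_of_nonneg fun q => hF0 _ _ _).2 ⟨fun p => ?_, ?_⟩
    · refine (summable_roughSum (k + 1) hs).of_nonneg_of_le (fun n => hF0 _ _ _) fun n => ?_
      simp only [hF]
      split_ifs
      · exact le_rfl
      · positivity
    · have h1 : (1 : ℝ) < (j + 1) * s := by nlinarith [j.cast_nonneg (α := ℝ)]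
      refine ((summable_primeSum (y := y) 0 h1).mul_left (roughSum (k - j) y s)).congr fun p => ?_
      rw [pow_zero, one_mul, roughSum_mul_rpow (k := k) (by omega) p.2]
  have h1 : ∀ q ∈ antidiagonal k, roughSum q.1 y s * primeSum y 0 ((q.2 + 1) * s) =
      ∑' n, ∑' p, F q.2 p n := by
    intro q hq
    have hq' := mem_antidiagonal.1 hq
    rw [(hprod q.2 (by omega)).tsum_comm, primeSum, ← tsum_mul_left]
    refine tsum_congr fun p => ?_
    rw [pow_zero, one_mul, roughSum_mul_rpow hq' p.2]
  rw [sum_congr rfl h1, ← Nat.sum_antidiagonal_swap, Nat.sum_antidiagonal_eq_sum_range_succ_mk]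
  simp only [Prod.swap]
  rw [← Summable.tsum_finsetSum, roughSum, ← tsum_mul_right]
  · refine tsum_congr fun n => ?_
    rw [sum_tsum_ite_pow_dvd, mul_comm]
  · intro j hj
    exact (hprod j (by have := mem_range.1 hj; omega)).prod_symm.prod

/-- The logarithm `∑ P (m s) X ^ m / m` of the generating series of `roughSum`. -/
noncomputable def roughLog (y : ℕ) (s : ℝ) : ℝ⟦X⟧ := mk fun m => primeSum y 0 (m * s) / m

lemma constantCoeff_roughLog (s : ℝ) : constantCoeff (roughLog y s) = 0 := by
  rw [← coeff_zero_eq_constantCoeff_apply]; simp [roughLog]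

/-- Newton's identity is the differential equation F' = F L' read coefficientwise. -/
lemma coeff_expS_roughLog (k : ℕ) {s : ℝ} (hs : 1 < s) :
    coeff k (expS (roughLog y s)) = roughSum k y s := by
  have : (mk fun k => roughSum k y s) = expS (roughLog y s) := by
    refine expS_unique (constantCoeff_roughLog s) (by simp [roughSum_zero]) ?_
    ext k
    rw [coeff_derivative, coeff_mul, coeff_mk, succ_mul_roughSum k hs]
    refine sum_congr rfl fun q _ => ?_
    rw [coeff_derivative, coeff_mk, roughLog, coeff_mk]
    push_cast
    field_simp
  rw [← this, coeff_mk]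

/-! ### The series and product in the constants, in terms of prime sums. -/

lemma one_sub_rpow_neg_pos {p : ℕ} (hp : p.Prime) {w : ℝ} (hw : 0 < w) :
    0 < 1 - (p : ℝ) ^ (-w) := by
  have := Real.rpow_lt_one_of_one_lt_of_neg (x := (p : ℝ)) (z := -w)
    (by exact_mod_cast hp.one_lt) (by linarith)
  linarith

/-- Interchange of a sum over exponents with a sum over primes. -/
lemma tsum_mul_primeSum (hy : 2 ≤ y) (i : ℕ) {c : ℕ → ℝ} {B : ℝ} (hc : ∀ m, |c m| ≤ B * 2 ^ m)
    {x : ℝ} (hx : 0 ≤ x) {g : ℕ → ℝ}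
    (hg : ∀ p ∈ primesAbove y, HasSum (fun m => c m * ((p : ℝ) ^ (-(1 + x))) ^ (m + 2)) (g p)) :
    Summable (fun m => c m * primeSum y i ((m + 2) * (1 + x))) ∧
    HasSum (fun p : primesAbove y => Real.log (p : ℕ) ^ i * g p)
      (∑' m, c m * primeSum y i ((m + 2) * (1 + x))) := by
  have hB : 0 ≤ B := by simpa using (abs_nonneg _).trans (hc 0)
  set F : ℕ × primesAbove y → ℝ := fun q =>
    c q.1 * (Real.log (q.2 : ℕ) ^ i * ((q.2 : ℕ) : ℝ) ^ (-((q.1 + 2) * (1 + x)))) with hF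
  have hm : ∀ m : ℕ, (1 : ℝ) < (m + 2) * (1 + x) := fun m => by
    nlinarith [mul_nonneg (by positivity : (0 : ℝ) ≤ m + 2) hx, m.cast_nonneg (α := ℝ)]
  -- The growth 2^m allowed for c is beaten by the decay 3^(-m); this is what permits evaluation at
  -- X = 2.
  have hbound : Summable fun m : ℕ => B * primeSum y i 2 * (2 / 3 : ℝ) ^ m :=
    (summable_geometric_of_lt_one (by norm_num) (by norm_num)).mul_left _
  have hle : ∀ m : ℕ, |c m| * primeSum y i ((m + 2) * (1 + x)) ≤
      B * primeSum y i 2 * (2 / 3 : ℝ) ^ m := fun m => by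
    have h0 := primeSum_nonneg (y := y) i 2
    calc _ ≤ (B * 2 ^ m) * ((1 / 3) ^ m * primeSum y i 2) :=
          mul_le_mul (hc m) (primeSum_mul_le hy i m hx) (primeSum_nonneg _ _) (by positivity)
      _ = _ := by rw [div_pow, div_pow, one_pow]; ring
  have hlog : ∀ p : primesAbove y, 0 ≤ Real.log (p : ℕ) := fun p =>
    (log_pos_of_mem_primesAbove p).le
  have hsum : Summable F := by
    rw [← summable_abs_iff]
    refine (summable_prod_of_nonneg fun q => abs_nonneg _).2 ⟨fun m => ?_, ?_⟩
    · refine ((summable_primeSum i (hm m)).mul_left |c m|).congr fun p => ?_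
      have := hlog p
      simp only [hF]
      rw [abs_mul, abs_of_nonneg (a := _ * _) (by positivity)]
    · refine (hbound.of_nonneg_of_le (fun m => mul_nonneg (abs_nonneg _) (primeSum_nonneg _ _))
        hle).congr fun m => ?_
      rw [primeSum, ← tsum_mul_left]
      refine tsum_congr fun p => ?_
      have := hlog p
      simp only [hF]
      rw [abs_mul, abs_of_nonneg (a := _ * _) (by positivity)]
  have h1 : ∀ m : ℕ, c m * primeSum y i ((m + 2) * (1 + x)) = ∑' p, F (m, p) := fun m => by
    rw [primeSum, ← tsum_mul_left]
  have h2 : ∀ p : primesAbove y, HasSum (fun m => F (m, p)) (Real.log (p : ℕ) ^ i * g p) := by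
    intro p
    convert! (hg p p.2).mul_left (Real.log (p : ℕ) ^ i) using 2 with m
    have hp0 := pos_of_mem_primesAbove p
    simp only [hF]
    rw [← Real.rpow_natCast (_ ^ _), ← Real.rpow_mul hp0.le]
    push_cast
    ring_nf
  simp only [h1]
  refine ⟨hsum.prod, ?_⟩
  rw [← hsum.tsum_prod]
  have h3 := (Equiv.prodComm (primesAbove y) ℕ).hasSum_iff.2 hsum.hasSum
  exact h3.prod_fiberwise h2

lemma hasSum_pow_add_two_div {r : ℝ} (hr : |r| < 1) :
    HasSum (fun m : ℕ => 1 / ((m : ℝ) + 2) * r ^ (m + 2)) (-Real.log (1 - r) - r) := by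
  have h := (hasSum_nat_add_iff' 1).2 (Real.hasSum_pow_div_log_of_abs_lt_one hr)
  simp only [range_one, sum_singleton, Nat.cast_zero, zero_add, pow_one, div_one] at h
  convert! h using 2 with m
  push_cast
  ring

lemma hasSum_pow_add_two {r : ℝ} (h0 : 0 ≤ r) (hr : r < 1) :
    HasSum (fun m : ℕ => r ^ (m + 2)) (r ^ 2 / (1 - r)) := by
  rw [div_eq_inv_mul]
  simpa only [pow_add] using (hasSum_geometric_of_lt_one h0 hr).mul_right (r ^ 2)

lemma hasSum_higherSum_zero (hy : 2 ≤ y) {x : ℝ} (hx : 0 ≤ x) :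
    HasSum (fun p : primesAbove y =>
      -Real.log (1 - ((p : ℕ) : ℝ) ^ (-(1 + x))) - ((p : ℕ) : ℝ) ^ (-(1 + x)))
      (higherSum y 0 x) := by
  have h := (tsum_mul_primeSum hy 0 (c := fun m => 1 / ((m : ℝ) + 2)) (B := 1) (fun m => by
    rw [abs_of_nonneg (by positivity), one_mul]
    have h1 : (1 : ℝ) ≤ 2 ^ m := one_le_pow₀ (by norm_num)
    refine le_trans ?_ h1
    rw [div_le_one (by positivity)]
    linarith [m.cast_nonneg (α := ℝ)]) hx
    (g := fun p => -Real.log (1 - (p : ℝ) ^ (-(1 + x))) - (p : ℝ) ^ (-(1 + x)))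
    (fun p hp => hasSum_pow_add_two_div (by
      rw [abs_of_nonneg (by positivity)]
      linarith [one_sub_rpow_neg_pos hp.1 (by linarith : 0 < 1 + x)]))).2
  simpa [higherSum] using h

/-- The bracket is ∑_{m ≥ 2} (2^m - 2) p^(-m), the shape that evaluation at X = 2 produces. -/
lemma cTerm_eq {p : ℕ} (hp : p ∈ primesAbove 2) : 2 * cTerm p = Real.log p ^ 1 *
    ((2 / (p : ℝ)) ^ 2 / (1 - 2 / p) - 2 * ((1 / (p : ℝ)) ^ 2 / (1 - 1 / p))) := by
  have h3 : (3 : ℝ) ≤ p := by exact_mod_cast hp.2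
  have h0 : (p : ℝ) ≠ 0 := by linarith
  have h1 : (p : ℝ) - 1 ≠ 0 := by linarith
  have h2 : (p : ℝ) - 2 ≠ 0 := by linarith
  have h4 : 1 - 2 / (p : ℝ) = (p - 2) / p := by field_simp
  have h5 : 1 - 1 / (p : ℝ) = (p - 1) / p := by field_simp
  rw [cTerm, h4, h5]
  field_simp
  ring

lemma primesAbove_anti (hy : 2 ≤ y) {p : ℕ} (hp : p ∈ primesAbove y) : p ∈ primesAbove 2 :=
  ⟨hp.1, hy.trans_lt hp.2⟩

lemma rpow_neg_one_add_zero (p : ℕ) : (p : ℝ) ^ (-(1 + 0 : ℝ)) = 1 / p := by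
  rw [add_zero, Real.rpow_neg_one, one_div]

lemma hasSum_cTerm (hy : 2 ≤ y) :
    Summable (fun m : ℕ => ((2 : ℝ) ^ (m + 2) - 2) * primeSum y 1 ((m + 2) * (1 + 0))) ∧
    HasSum (fun p : primesAbove y => 2 * cTerm p)
      (∑' m : ℕ, ((2 : ℝ) ^ (m + 2) - 2) * primeSum y 1 ((m + 2) * (1 + 0))) := by
  have h := tsum_mul_primeSum hy 1 (c := fun m => (2 : ℝ) ^ (m + 2) - 2) (B := 4) (fun m => by
    have h1 : (1 : ℝ) ≤ 2 ^ m := one_le_pow₀ (by norm_num)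
    rw [pow_add, abs_of_nonneg (by linarith)]
    linarith) le_rfl
    (g := fun p => (2 / (p : ℝ)) ^ 2 / (1 - 2 / p) - 2 * ((1 / (p : ℝ)) ^ 2 / (1 - 1 / p)))
    (fun p hp => by
      have h3 : (3 : ℝ) ≤ p := by exact_mod_cast (primesAbove_anti hy hp).2
      have h2 := hasSum_pow_add_two (r := 2 / (p : ℝ)) (by positivity)
        (by rw [div_lt_one (by linarith)]; linarith)
      have h1 := hasSum_pow_add_two (r := 1 / (p : ℝ)) (by positivity)
        (by rw [div_lt_one (by linarith)]; linarith)
      convert! h2.sub (h1.mul_left 2) using 2 with m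
      rw [rpow_neg_one_add_zero, div_pow, div_pow, one_pow]
      ring)
  refine ⟨h.1, ?_⟩
  convert! h.2 using 2 with p
  exact cTerm_eq (primesAbove_anti hy p.2)

/-- The inserted linear terms -2/p and +2/p cancel, so the logarithm is a series starting at m = 2.
-/
lemma log_dFactor {p : ℕ} (hp : p ∈ primesAbove 2) : 0 < dFactor p ∧ Real.log (dFactor p) =
    (-Real.log (1 - 2 / p) - 2 / p) - 2 * (-Real.log (1 - 1 / p) - 1 / p) := by
  have h3 : (3 : ℝ) ≤ p := by exact_mod_cast hp.2
  have h2 : 0 < 1 - 2 / (p : ℝ) := by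
    rw [sub_pos, div_lt_one (by linarith)]; linarith
  have h1 : 0 < 1 - 1 / (p : ℝ) := by
    rw [sub_pos, div_lt_one (by linarith)]; linarith
  refine ⟨by unfold dFactor; positivity, ?_⟩
  rw [dFactor, Real.log_mul (by positivity) (by positivity), Real.log_inv, Real.log_pow]
  push_cast
  ring

lemma hasSum_log_dFactor (hy : 2 ≤ y) :
    Summable (fun m : ℕ => ((2 : ℝ) ^ (m + 2) - 2) / (m + 2) *
      primeSum y 0 ((m + 2) * (1 + 0))) ∧
    HasSum (fun p : primesAbove y => Real.log (dFactor p))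
      (∑' m : ℕ, ((2 : ℝ) ^ (m + 2) - 2) / (m + 2) * primeSum y 0 ((m + 2) * (1 + 0))) := by
  have h := tsum_mul_primeSum hy 0 (c := fun m => ((2 : ℝ) ^ (m + 2) - 2) / (m + 2)) (B := 4)
    (fun m => by
    have h1 : (1 : ℝ) ≤ 2 ^ m := one_le_pow₀ (by norm_num)
    have h0 : 0 ≤ (2 : ℝ) ^ (m + 2) - 2 := by rw [pow_add]; linarith
    rw [abs_of_nonneg (by positivity)]
    refine (div_le_self h0 (by linarith [m.cast_nonneg (α := ℝ)])).trans ?_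
    rw [pow_add]
    linarith) le_rfl
    (g := fun p => (-Real.log (1 - 2 / p) - 2 / p) - 2 * (-Real.log (1 - 1 / p) - 1 / p))
    (fun p hp => by
      have h3 : (3 : ℝ) ≤ p := by exact_mod_cast (primesAbove_anti hy hp).2
      have h2 := hasSum_pow_add_two_div (r := 2 / (p : ℝ))
        (by rw [abs_of_nonneg (by positivity), div_lt_one (by linarith)]; linarith)
      have h1 := hasSum_pow_add_two_div (r := 1 / (p : ℝ))
        (by rw [abs_of_nonneg (by positivity), div_lt_one (by linarith)]; linarith)
      convert! h2.sub (h1.mul_left 2) using 2 with m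
      rw [rpow_neg_one_add_zero, div_pow, div_pow, one_pow]
      ring)
  refine ⟨h.1, ?_⟩
  convert! h.2 using 2 with p
  rw [(log_dFactor (primesAbove_anti hy p.2)).2]
  ring

lemma hasProd_dFactor (hy : 2 ≤ y) : HasProd (fun p : primesAbove y => dFactor p) (Real.exp
    (∑' m : ℕ, ((2 : ℝ) ^ (m + 2) - 2) / (m + 2) * primeSum y 0 ((m + 2) * (1 + 0)))) := by
  convert! (hasSum_log_dFactor hy).2.rexp using 1
  ext p
  rw [Function.comp_apply, Real.exp_log (log_dFactor (primesAbove_anti hy p.2)).1]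

lemma setOf_prime_eq : {p : ℕ | p.Prime} = ↑(primesUpTo y) ∪ primesAbove y := by
  ext p
  simp only [primesUpTo, primesAbove, Set.mem_ofPred_eq, Set.mem_union, Finset.mem_coe,
    Finset.mem_filter, Finset.mem_Icc]
  constructor
  · intro hp
    have := hp.one_le
    rcases le_or_gt p y with h | h
    · exact Or.inl ⟨⟨this, h⟩, hp⟩
    · exact Or.inr ⟨hp, h⟩
  · rintro (h | h)
    · exact h.2
    · exact h.1

lemma disjoint_primesUpTo_primesAbove : Disjoint (↑(primesUpTo y) : Set ℕ) (primesAbove y) := by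
  rw [Set.disjoint_left]
  intro p h1 h2
  have := (Finset.mem_Icc.1 (Finset.mem_filter.1 h1).1).2
  have := h2.2
  omega

/-- For 2 < p ≤ y the factor 1 - 2/p turns `dFactor p` into (1 - 1/p)^2, and the 1/4 in `d` is the
same square at p = 2. -/
lemma dSifted_eq (hy : 2 ≤ y) : dSifted y =
    (∏ p ∈ primesUpTo y, (1 - 1 / (p : ℝ))) ^ 2 * ∏' p : primesAbove y, dFactor p := by
  have hsplit : primesAbove 2 = ↑({p ∈ primesUpTo y | 2 < p} : Finset ℕ) ∪ primesAbove y := by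
    ext p
    simp only [primesUpTo, primesAbove, Set.mem_ofPred_eq, Set.mem_union, Finset.mem_coe,
      Finset.mem_filter, Finset.mem_Icc]
    constructor
    · rintro ⟨hp, h2⟩
      rcases le_or_gt p y with h | h
      · exact Or.inl ⟨⟨⟨by omega, h⟩, hp⟩, h2⟩
      · exact Or.inr ⟨hp, h⟩
    · rintro (h | h)
      · exact ⟨h.1.2, h.2⟩
      · exact ⟨h.1, by omega⟩
  have hdisj : Disjoint (↑({p ∈ primesUpTo y | 2 < p} : Finset ℕ) : Set ℕ) (primesAbove y) :=
    disjoint_primesUpTo_primesAbove.mono_left (by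
      exact_mod_cast Finset.filter_subset _ _)
  have h1 : ∏' p : primesAbove 2, dFactor p =
      (∏ p ∈ primesUpTo y with 2 < p, dFactor p) * ∏' p : primesAbove y, dFactor p := by
    rw [hsplit, Multipliable.tprod_union_disjoint (f := dFactor) hdisj
      (Finset.multipliable _ _) (hasProd_dFactor hy).multipliable, Finset.tprod_subtype']
  have h2 : ∏ p ∈ primesUpTo y, (1 - 1 / (p : ℝ)) =
      1 / 2 * ∏ p ∈ primesUpTo y with 2 < p, (1 - 1 / (p : ℝ)) := by
    have : primesUpTo y = insert 2 {p ∈ primesUpTo y | 2 < p} := by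
      ext p
      simp only [primesUpTo, Finset.mem_insert, Finset.mem_filter, Finset.mem_Icc]
      constructor
      · rintro ⟨h, hp⟩
        have := hp.two_le
        rcases eq_or_lt_of_le this with h2 | h2
        · exact Or.inl h2.symm
        · exact Or.inr ⟨⟨h, hp⟩, h2⟩
      · rintro (rfl | h)
        · exact ⟨⟨by norm_num, hy⟩, Nat.prime_two⟩
        · exact h.1
    conv_lhs => rw [this]
    rw [Finset.prod_insert (by simp)]
    norm_num
  rw [dSifted, d, h1, h2]
  have h3 : (∏ p ∈ primesUpTo y with 2 < p, dFactor p) *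
      ∏ p ∈ primesUpTo y with 2 < p, (1 - 2 / (p : ℝ)) =
      (∏ p ∈ primesUpTo y with 2 < p, (1 - 1 / (p : ℝ))) ^ 2 := by
    rw [← Finset.prod_mul_distrib, ← Finset.prod_pow]
    refine Finset.prod_congr rfl fun p hp => ?_
    have hp2 : (2 : ℝ) < p := by exact_mod_cast (Finset.mem_filter.1 hp).2
    have : 1 - 2 / (p : ℝ) ≠ 0 := by
      have : 2 / (p : ℝ) < 1 := by rw [div_lt_one (by linarith)]; exact hp2
      linarith
    rw [dFactor, mul_right_comm, inv_mul_cancel₀ this, one_mul]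
  rw [mul_pow, ← h3]
  ring

/-! ### The zeta function near 1 and the singularity of the prime sum. -/

/-- The entire function `(s - 1) ζ(s)`. -/
noncomputable def zetaReg : ℂ → ℂ := Function.update (fun s => (s - 1) * riemannZeta s) 1 1

lemma differentiable_zetaReg : Differentiable ℂ zetaReg := by
  rw [← differentiableOn_univ,
    ← Complex.differentiableOn_compl_singleton_and_continuousAt_iff (c := 1) Filter.univ_mem]
  refine ⟨DifferentiableOn.congr (f := fun s ↦ (s - 1) * riemannZeta s)
    (fun s hs ↦ ((differentiableAt_id.sub_const 1).mul
      (differentiableAt_riemannZeta (Set.mem_sdiff_singleton.mp hs).2)).differentiableWithinAt)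
    fun _ hs ↦ Function.update_of_ne (Set.mem_sdiff_singleton.mp hs).2 ..,
    continuousWithinAt_compl_self.mp ?_⟩
  unfold zetaReg
  simpa using riemannZeta_residue_one

/-- The slope at 1 is ζ(s) - 1/(s-1), which tends to γ. -/
lemma hasDerivAt_zetaReg_one : HasDerivAt zetaReg (Real.eulerMascheroniConstant : ℂ) 1 := by
  rw [hasDerivAt_iff_tendsto_slope]
  refine tendsto_riemannZeta_sub_one_div.congr' ?_
  filter_upwards [self_mem_nhdsWithin] with s hs
  have hs : s ≠ 1 := hs
  have hs' : s - 1 ≠ 0 := sub_ne_zero.2 hs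
  rw [slope_def_field, zetaReg, Function.update_of_ne hs, Function.update_self]
  field_simp

/-- The real function `x ζ(1 + x)`. -/
noncomputable def zetaReal (x : ℝ) : ℝ := (zetaReg (1 + x)).re

lemma contDiff_zetaReal : ContDiff ℝ 2 zetaReal := by
  have h : ContDiff ℂ 2 fun z : ℂ => zetaReg (1 + z) :=
    differentiable_zetaReg.contDiff.comp (contDiff_const.add contDiff_id)
  exact h.real_of_complex

lemma zetaReal_zero : zetaReal 0 = 1 := by simp [zetaReal, zetaReg]

lemma hasDerivAt_zetaReal_zero : HasDerivAt zetaReal Real.eulerMascheroniConstant 0 := by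
  have h : HasDerivAt (fun z : ℂ => zetaReg (1 + z)) (Real.eulerMascheroniConstant : ℂ)
      ((0 : ℝ) : ℂ) := by
    have h1 : HasDerivAt zetaReg (Real.eulerMascheroniConstant : ℂ) (1 + ((0 : ℝ) : ℂ)) := by
      simpa using hasDerivAt_zetaReg_one
    exact h1.comp_const_add _ _
  have h2 := h.real_of_complex
  rw [Complex.ofReal_re] at h2
  exact h2

lemma summable_log_one_sub (w : ℝ) (hw : 1 < w) :
    Summable fun p : ({p : ℕ | p.Prime} : Set ℕ) => -Real.log (1 - ((p : ℕ) : ℝ) ^ (-w)) := by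
  have h : Summable fun p : ({p : ℕ | p.Prime} : Set ℕ) => 2 * ((p : ℕ) : ℝ) ^ (-w) :=
    ((Real.summable_nat_rpow.2 (by linarith)).subtype _).mul_left 2
  refine h.of_nonneg_of_le (fun p => ?_) fun p => ?_
  · have hp := one_sub_rpow_neg_pos p.2 (by linarith : 0 < w)
    have := Real.log_nonpos hp.le (by
      have : (0 : ℝ) ≤ ((p : ℕ) : ℝ) ^ (-w) := by positivity
      linarith)
    linarith
  · have hp2 : (2 : ℝ) ≤ (p : ℕ) := by exact_mod_cast p.2.two_le
    have hhalf : ((p : ℕ) : ℝ) ^ (-w) ≤ 1 / 2 := by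
      calc ((p : ℕ) : ℝ) ^ (-w) ≤ ((p : ℕ) : ℝ) ^ (-1 : ℝ) :=
            Real.rpow_le_rpow_of_exponent_le (by linarith) (by linarith)
        _ ≤ 1 / 2 := by
            rw [Real.rpow_neg_one, ← one_div]
            exact one_div_le_one_div_of_le (by norm_num) hp2
    have hp0 : (0 : ℝ) ≤ ((p : ℕ) : ℝ) ^ (-w) := by positivity
    set t := ((p : ℕ) : ℝ) ^ (-w)
    have h1 : 0 < 1 - t := by linarith
    rw [← Real.log_inv]
    -- Here -log(1-t) ≤ t/(1-t) ≤ 2t, since t ≤ 1/2.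
    refine (Real.log_le_sub_one_of_pos (by positivity)).trans ?_
    rw [inv_eq_one_div, div_sub_one h1.ne', div_le_iff₀ h1]
    nlinarith

lemma zetaReal_eq_mul_exp {x : ℝ} (hx : 0 < x) : zetaReal x = x * Real.exp
    (∑' p : ({p : ℕ | p.Prime} : Set ℕ), -Real.log (1 - ((p : ℕ) : ℝ) ^ (-(1 + x)))) := by
  have h := riemannZeta_eulerProduct_exp_log (s := ((1 + x : ℝ) : ℂ))
    (by rw [Complex.ofReal_re]; linarith)
  have h1 : ∑' p : Nat.Primes, -Complex.log (1 - (p : ℂ) ^ (-((1 + x : ℝ) : ℂ))) =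
      ((∑' p : ({p : ℕ | p.Prime} : Set ℕ),
        -Real.log (1 - ((p : ℕ) : ℝ) ^ (-(1 + x))) : ℝ) : ℂ) := by
    rw [Complex.ofReal_tsum]
    let e : Nat.Primes ≃ ({p : ℕ | p.Prime} : Set ℕ) := Equiv.subtypeEquivRight fun p => Iff.rfl
    rw [← e.tsum_eq]
    refine tsum_congr fun p => ?_
    have hp := one_sub_rpow_neg_pos p.2 (by linarith : 0 < 1 + x)
    change _ = ((-Real.log (1 - ((p : ℕ) : ℝ) ^ (-(1 + x))) : ℝ) : ℂ)
    rw [Complex.ofReal_neg, Complex.ofReal_log hp.le, Complex.ofReal_sub,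
      Complex.ofReal_cpow (by positivity)]
    push_cast
    rfl
  rw [h1, ← Complex.ofReal_exp] at h
  have hne : (1 + (x : ℂ)) ≠ 1 := by
    intro h
    have : (x : ℂ) = 0 := by simpa using h
    exact hx.ne' (by exact_mod_cast this)
  rw [zetaReal, zetaReg, Function.update_of_ne hne]
  have h2 : (1 + (x : ℂ)) = ((1 + x : ℝ) : ℂ) := by push_cast; rfl
  rw [h2, ← h, ← Complex.ofReal_one, ← Complex.ofReal_sub, ← Complex.ofReal_mul,
    Complex.ofReal_re]
  ring

lemma zetaReal_pos {x : ℝ} (hx : 0 ≤ x) : 0 < zetaReal x := by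
  rcases hx.eq_or_lt with rfl | hx
  · rw [zetaReal_zero]; exact one_pos
  · rw [zetaReal_eq_mul_exp hx]; positivity

/-- The regular part of `∑_{p > y} -log (1 - p ^ (-(1 + x)))` at `x = 0`. -/
noncomputable def regLog (y : ℕ) (x : ℝ) : ℝ :=
  Real.log (zetaReal x) + ∑ p ∈ primesUpTo y, Real.log (1 - (p : ℝ) ^ (-(1 + x)))

lemma prime_of_mem_primesUpTo {p : ℕ} (hp : p ∈ primesUpTo y) : p.Prime :=
  (Finset.mem_filter.1 hp).2

/-- The finite sum in `regLog` cancels the Euler factors at p ≤ y, leaving the primes above y and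
the log x coming from x ζ(1+x). -/
lemma regLog_eq {x : ℝ} (hx : 0 < x) : regLog y x =
    Real.log x + ∑' p : primesAbove y, -Real.log (1 - ((p : ℕ) : ℝ) ^ (-(1 + x))) := by
  have hs := summable_log_one_sub (1 + x) (by linarith)
  have h := zetaReal_eq_mul_exp hx
  set f : ℕ → ℝ := fun p => -Real.log (1 - (p : ℝ) ^ (-(1 + x))) with hf
  have hsub : primesAbove y ⊆ {p : ℕ | p.Prime} := fun p hp => hp.1
  have hs' : Summable (f ∘ (↑) : primesAbove y → ℝ) := by
    have := hs.comp_injective (Set.inclusion_injective hsub)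
    exact this
  have h1 : ∑' p : ({p : ℕ | p.Prime} : Set ℕ), f p =
      ∑ p ∈ primesUpTo y, f p + ∑' p : primesAbove y, f p := by
    have key : ∀ s : Set ℕ, s = ↑(primesUpTo y) ∪ primesAbove y →
        ∑' p : s, f p = ∑ p ∈ primesUpTo y, f p + ∑' p : primesAbove y, f p := by
      rintro _ rfl
      rw [Summable.tsum_union_disjoint (f := f) disjoint_primesUpTo_primesAbove
        (Finset.summable (primesUpTo y) f) hs', Finset.tsum_subtype']
    exact key _ setOf_prime_eq
  rw [regLog, h, Real.log_mul hx.ne' (Real.exp_ne_zero _), Real.log_exp]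
  change _ + ∑' p : ({p : ℕ | p.Prime} : Set ℕ), f p + _ = _
  rw [h1]
  simp only [hf, sum_neg_distrib]
  ring

lemma exp_regLog_zero : Real.exp (regLog y 0) = ∏ p ∈ primesUpTo y, (1 - 1 / (p : ℝ)) := by
  rw [regLog, zetaReal_zero, Real.log_one, zero_add, Real.exp_sum]
  refine prod_congr rfl fun p hp => ?_
  rw [Real.exp_log (one_sub_rpow_neg_pos (prime_of_mem_primesUpTo hp) (by norm_num)),
    rpow_neg_one_add_zero]

/-- The prime sum at `1 + x` is `-log x` plus a function that is smooth at `x = 0`. -/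
lemma primeSum_eq (hy : 2 ≤ y) {x : ℝ} (hx : 0 < x) :
    primeSum y 0 (1 + x) = regLog y x - higherSum y 0 x - Real.log x := by
  have h1 := hasSum_higherSum_zero hy hx.le
  have h2 := (summable_primeSum (y := y) 0 (w := 1 + x) (by linarith)).hasSum
  have h3 := (h1.add h2).tsum_eq
  simp only [pow_zero, one_mul, sub_add_cancel] at h3
  rw [regLog_eq hx, h3, primeSum]
  simp only [pow_zero, one_mul]
  ring

lemma contDiffOn_regLog : ContDiffOn ℝ 2 (regLog y) (Set.Ioi (-1) ∩ {x | 0 < zetaReal x}) := by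
  unfold regLog
  refine ContDiffOn.add ?_ (ContDiffOn.sum fun p hp => ?_)
  · exact contDiff_zetaReal.contDiffOn.log fun x hx => ne_of_gt hx.2
  · have hpp := prime_of_mem_primesUpTo hp
    have hp0 : (p : ℝ) ≠ 0 := by exact_mod_cast hpp.ne_zero
    refine ContDiffOn.log ?_ fun x hx => (one_sub_rpow_neg_pos hpp
      (by have := hx.1; simp only [Set.mem_Ioi] at this; linarith)).ne'
    have h : (fun x : ℝ => 1 - (p : ℝ) ^ (-(1 + x))) =
        fun x => 1 - Real.exp (Real.log p * (-(1 + x))) := by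
      ext x
      rw [Real.rpow_def_of_pos (by exact_mod_cast hpp.pos)]
    rw [h]
    exact ContDiff.contDiffOn (by fun_prop)

/-- This supplies the first two terms of c_y: γ from ζ and log p/(p-1) from each removed Euler
factor. -/
lemma hasDerivAt_regLog_zero : HasDerivAt (regLog y)
    (Real.eulerMascheroniConstant + ∑ p ∈ primesUpTo y, Real.log p / ((p : ℝ) - 1)) 0 := by
  unfold regLog
  refine HasDerivAt.add ?_ (HasDerivAt.fun_sum fun p hp => ?_)
  · have := hasDerivAt_zetaReal_zero.log (by rw [zetaReal_zero]; norm_num)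
    simpa [zetaReal_zero] using this
  · have hpp := prime_of_mem_primesUpTo hp
    have hp0 : (0 : ℝ) < p := by exact_mod_cast hpp.pos
    have hp1 : (1 : ℝ) < p := by exact_mod_cast hpp.one_lt
    have h1 : HasDerivAt (fun x : ℝ => -(1 + x)) (-1) 0 := ((hasDerivAt_id _).const_add 1).neg
    have h2 := ((h1.const_rpow hp0).const_sub 1).log
      (one_sub_rpow_neg_pos hpp (by norm_num)).ne'
    convert! h2 using 1
    rw [rpow_neg_one_add_zero]
    have : (p : ℝ) - 1 ≠ 0 := by linarith
    have h4 : 1 - 1 / (p : ℝ) = (p - 1) / p := by field_simp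
    rw [h4]
    field_simp

/-- The first two derivatives of `regLog`. -/
lemma regLog_derivs : ∃ a1 a2 : ℝ → ℝ,
    (∀ x ∈ Set.Icc (0 : ℝ) 1, HasDerivAt (regLog y) (a1 x) x) ∧
    (∀ x ∈ Set.Icc (0 : ℝ) 1, HasDerivAt a1 (a2 x) x) ∧
    ContinuousOn a2 (Set.Icc 0 1) := by
  -- An open neighbourhood of [0,1], so that the derivatives at the endpoints are genuine two-sided
  -- ones.
  set U : Set ℝ := Set.Ioi (-1) ∩ {x | 0 < zetaReal x}
  have hU : IsOpen U := isOpen_Ioi.inter (isOpen_lt continuous_const contDiff_zetaReal.continuous)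
  have hsub : Set.Icc (0 : ℝ) 1 ⊆ U := fun x hx =>
    ⟨by simp only [Set.mem_Ioi]; linarith [hx.1], zetaReal_pos hx.1⟩
  have h0 := contDiffOn_regLog (y := y)
  have h1 : ContDiffOn ℝ 1 (deriv (regLog y)) U := h0.deriv_of_isOpen hU (by norm_num)
  have h2 : ContDiffOn ℝ 0 (deriv (deriv (regLog y))) U := h1.deriv_of_isOpen hU (by norm_num)
  refine ⟨deriv (regLog y), deriv (deriv (regLog y)), fun x hx => ?_, fun x hx => ?_, ?_⟩
  · exact ((h0.differentiableOn (by norm_num)).differentiableAt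
      (hU.mem_nhds (hsub hx))).hasDerivAt
  · exact ((h1.differentiableOn (by norm_num)).differentiableAt
      (hU.mem_nhds (hsub hx))).hasDerivAt
  · exact h2.continuousOn.mono hsub

/-! ### Integrals over (0, 1]. -/

lemma image_exp_neg_Ioi : (fun t : ℝ => Real.exp (-t)) '' Set.Ioi 0 = Set.Ioo 0 1 := by
  ext x
  constructor
  · rintro ⟨t, ht, rfl⟩
    exact ⟨Real.exp_pos _, by simpa using ht⟩
  · rintro ⟨h0, h1⟩
    exact ⟨-Real.log x, neg_pos.2 (Real.log_neg h0 h1), by simp [Real.exp_log h0]⟩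

lemma integrableOn_pow_mul_exp_neg_mul (j i : ℕ) :
    IntegrableOn (fun t : ℝ => t ^ j * Real.exp (-((i + 1) * t))) (Set.Ioi 0) ∧
    ∫ t in Set.Ioi (0 : ℝ), t ^ j * Real.exp (-((i + 1) * t)) =
      j.factorial / ((i : ℝ) + 1) ^ (j + 1) := by
  have hi : (0 : ℝ) < i + 1 := by positivity
  constructor
  · have h := integrableOn_rpow_mul_exp_neg_mul_rpow (s := j) (p := 1) (b := i + 1)
      (by linarith [j.cast_nonneg (α := ℝ)]) one_pos hi
    simpa only [Real.rpow_natCast, Real.rpow_one, neg_mul] using h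
  · have h := Real.integral_rpow_mul_exp_neg_mul_Ioi (a := j + 1) (r := i + 1) (by positivity) hi
    rw [add_sub_cancel_right, Real.Gamma_nat_eq_factorial] at h
    simp only [Real.rpow_natCast] at h
    rw [h, one_div, Real.inv_rpow hi.le]
    rw [show (j : ℝ) + 1 = ((j + 1 : ℕ) : ℝ) by push_cast; rfl, Real.rpow_natCast]
    field_simp

/-- The integral of `x ^ i (-log x) ^ j / j!` over `(0, 1]`. -/
lemma integral_pow_mul_neg_log_pow (i j : ℕ) :
    IntegrableOn (fun x : ℝ => x ^ i * ((-Real.log x) ^ j / j.factorial)) (Set.Ioc 0 1) ∧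
    ∫ x in Set.Ioc (0 : ℝ) 1, x ^ i * ((-Real.log x) ^ j / j.factorial) =
      1 / ((i : ℝ) + 1) ^ (j + 1) := by
  -- The substitution x = e^(-t) turns the integral into a Gamma integral.
  have hd : ∀ t ∈ Set.Ioi (0 : ℝ),
      HasDerivWithinAt (fun t : ℝ => Real.exp (-t)) (-Real.exp (-t)) (Set.Ioi 0) t := fun t _ => by
    simpa using ((hasDerivAt_neg t).exp).hasDerivWithinAt
  have hinj : Set.InjOn (fun t : ℝ => Real.exp (-t)) (Set.Ioi 0) := fun a _ b _ h => by
    simpa using h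
  set g : ℝ → ℝ := fun x => x ^ i * ((-Real.log x) ^ j / j.factorial)
  have hg : (fun t : ℝ => |-Real.exp (-t)| • g (Real.exp (-t))) =
      fun t => (j.factorial : ℝ)⁻¹ * (t ^ j * Real.exp (-((i + 1) * t))) := by
    ext t
    simp only [g, abs_neg, abs_of_pos (Real.exp_pos _), Real.log_exp, neg_neg, smul_eq_mul]
    rw [← Real.exp_nat_mul, show -(((i : ℝ) + 1) * t) = -t + i * -t by ring, Real.exp_add]
    ring
  have h1 := integrableOn_image_iff_integrableOn_abs_deriv_smul measurableSet_Ioi hd hinj g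
  have h2 := integral_image_eq_integral_abs_deriv_smul measurableSet_Ioi hd hinj g
  rw [image_exp_neg_Ioi, hg] at h1 h2
  obtain ⟨h3, h4⟩ := integrableOn_pow_mul_exp_neg_mul j i
  rw [integrableOn_Ioc_iff_integrableOn_Ioo, integral_Ioc_eq_integral_Ioo, h2,
    integral_const_mul, h4]
  refine ⟨h1.2 (h3.const_mul _), ?_⟩
  have : (j.factorial : ℝ) ≠ 0 := by positivity
  field_simp

/-- The last term is the tail of the integral over x > 1. -/
lemma integral_natCast_rpow {n : ℕ} (hn : 2 ≤ n) :
    term n = (∫ x in Set.Ioc (0 : ℝ) 1, (n : ℝ) ^ (-(1 + x))) +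
      (n : ℝ) ^ (-(2 : ℝ)) / Real.log n := by
  have hn0 : (0 : ℝ) < n := by positivity
  have hlog : 0 < Real.log n := Real.log_pos (by exact_mod_cast hn)
  have hd : ∀ x ∈ Set.uIcc (0 : ℝ) 1, HasDerivAt (fun x : ℝ => -((n : ℝ) ^ (-(1 + x)) / Real.log n))
      ((n : ℝ) ^ (-(1 + x))) x := fun x _ => by
    have h1 : HasDerivAt (fun x : ℝ => -(1 + x)) (-1) x := ((hasDerivAt_id x).const_add 1).neg
    have h := (h1.const_rpow hn0).div_const (Real.log n)
    convert! h.neg using 1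
    field_simp
  rw [← intervalIntegral.integral_of_le zero_le_one,
    intervalIntegral.integral_eq_sub_of_hasDerivAt hd]
  · rw [rpow_neg_one_add_zero, term, show -(1 + 1 : ℝ) = -2 by norm_num]
    field_simp
    ring
  · refine Continuous.intervalIntegrable ?_ _ _
    exact Continuous.rpow continuous_const (by fun_prop) fun x => Or.inl hn0.ne'

/-! ### The regularised generating series and its expansion at x = 0. -/

/-- The power series `u X + ∑ v m X ^ (m + 2)`. -/
noncomputable def consSeries (u : ℝ) (v : ℕ → ℝ) : ℝ⟦X⟧ :=
  mk fun | 0 => 0 | 1 => u | m + 2 => v m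

lemma coeff_consSeries_zero (u : ℝ) (v : ℕ → ℝ) : coeff 0 (consSeries u v) = 0 := by
  simp [consSeries]

lemma coeff_consSeries_one (u : ℝ) (v : ℕ → ℝ) : coeff 1 (consSeries u v) = u := by
  rw [consSeries, coeff_mk]

lemma coeff_consSeries_add_two (u : ℝ) (v : ℕ → ℝ) (m : ℕ) :
    coeff (m + 2) (consSeries u v) = v m := by
  rw [consSeries, coeff_mk]

lemma constantCoeff_consSeries (u : ℝ) (v : ℕ → ℝ) : constantCoeff (consSeries u v) = 0 := by
  rw [← coeff_zero_eq_constantCoeff_apply, coeff_consSeries_zero]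

lemma ev_consSeries {u : ℝ} {v : ℕ → ℝ} {z : ℝ} (hs : Summable fun m => v m * z ^ (m + 2)) :
    ev (consSeries u v) z = u * z + ∑' m, v m * z ^ (m + 2) := by
  have h : Summable fun n => coeff n (consSeries u v) * z ^ n := by
    rw [← summable_nat_add_iff 2]
    simpa only [coeff_consSeries_add_two] using hs
  rw [ev, ← h.sum_add_tsum_nat_add 2]
  simp only [coeff_consSeries_add_two, sum_range_succ, range_zero, sum_empty,
    coeff_consSeries_zero, coeff_consSeries_one]
  ring

lemma hasDerivWithinAt_coeff_consSeries {u : ℝ → ℝ} {v : ℝ → ℕ → ℝ} {u' : ℝ} {v' : ℕ → ℝ}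
    {s : Set ℝ} {x : ℝ} (hu : HasDerivWithinAt u u' s x)
    (hv : ∀ m, HasDerivWithinAt (fun t => v t m) (v' m) s x) (n : ℕ) :
    HasDerivWithinAt (fun t => coeff n (consSeries (u t) (v t))) (coeff n (consSeries u' v'))
      s x := by
  match n with
  | 0 => simpa only [coeff_consSeries_zero] using hasDerivWithinAt_const x s (0 : ℝ)
  | 1 => simpa only [coeff_consSeries_one] using hu
  | m + 2 => simpa only [coeff_consSeries_add_two] using hv m

/-- The regularised logarithm of the generating series of `roughSum`. -/
noncomputable def regSeries (y : ℕ) (x : ℝ) : ℝ⟦X⟧ :=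
  consSeries (regLog y x - higherSum y 0 x) fun m => primeSum y 0 ((m + 2) * (1 + x)) / (m + 2)

/-- The singularity as x → 0 sits in the coefficient of X alone, so it exponentiates to the explicit
factor exp(-X log x). -/
lemma roughLog_eq (hy : 2 ≤ y) {x : ℝ} (hx : 0 < x) :
    roughLog y (1 + x) = regSeries y x + (-Real.log x) • X := by
  ext n
  rw [map_add, PowerSeries.coeff_smul, coeff_X, roughLog, coeff_mk, regSeries]
  match n with
  | 0 => simp [coeff_consSeries_zero]
  | 1 => simp [coeff_consSeries_one, primeSum_eq hy hx, sub_eq_add_neg]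
  | m + 2 => simp [coeff_consSeries_add_two]

lemma constantCoeff_regSeries (x : ℝ) : constantCoeff (regSeries y x) = 0 :=
  constantCoeff_consSeries _ _

lemma roughSum_eq (hy : 2 ≤ y) (k : ℕ) {x : ℝ} (hx : 0 < x) :
    roughSum k y (1 + x) = ∑ q ∈ antidiagonal k,
      coeff q.1 (expS (regSeries y x)) * ((-Real.log x) ^ q.2 / q.2.factorial) := by
  rw [← coeff_expS_roughLog k (by linarith), roughLog_eq hy hx,
    expS_add (constantCoeff_regSeries x) (by simp), coeff_mul]
  simp only [coeff_expS_X]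

lemma exists_abs_le_of_continuousOn {f : ℝ → ℝ} (hf : ContinuousOn f (Set.Icc 0 1)) :
    ∃ K, 0 ≤ K ∧ ∀ x ∈ Set.Icc (0 : ℝ) 1, |f x| ≤ K := by
  obtain ⟨K, hK⟩ := isCompact_Icc.exists_bound_of_continuousOn hf
  exact ⟨K, (norm_nonneg _).trans (hK 0 (by simp)), hK⟩

/-- The factors 3 and 9 compensate the shifts of the exponent of 1/3 by one and by two. -/
lemma abs_coeff_consSeries_le {u : ℝ} {v : ℕ → ℝ} {K M : ℝ} (hK : 0 ≤ K) (hM : 0 ≤ M) {α : ℕ}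
    (hu : |u| ≤ K) (hv : ∀ m : ℕ, |v m| ≤ M * (m + 2) ^ α * (1 / 3) ^ m) (n : ℕ) :
    |coeff n (consSeries u v)| ≤ (3 * K + 9 * M) * (n + 1) ^ α * (1 / 3) ^ n := by
  match n with
  | 0 => rw [coeff_consSeries_zero, abs_zero]; positivity
  | 1 =>
    rw [coeff_consSeries_one]
    have h1 : (1 : ℝ) ≤ ((1 : ℕ) + 1) ^ α := one_le_pow₀ (by norm_num)
    calc |u| ≤ K := hu
      _ ≤ (3 * K + 9 * M) * 1 * (1 / 3) ^ 1 := by norm_num; linarith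
      _ ≤ _ := by gcongr
  | m + 2 =>
    rw [coeff_consSeries_add_two]
    refine (hv m).trans ?_
    calc M * ((m : ℝ) + 2) ^ α * (1 / 3) ^ m = 9 * M * (m + 2) ^ α * (1 / 3) ^ (m + 2) := by
          rw [pow_add]; ring
      _ ≤ (3 * K + 9 * M) * ((m + 2 : ℕ) + 1) ^ α * (1 / 3) ^ (m + 2) := by
          have h1 : (m : ℝ) + 2 ≤ ((m + 2 : ℕ) : ℝ) + 1 := by push_cast; linarith
          have h2 : 9 * M ≤ 3 * K + 9 * M := by linarith
          exact mul_le_mul_of_nonneg_right (mul_le_mul h2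
            (pow_le_pow_left₀ (by positivity) h1 α) (by positivity) (by positivity))
            (by positivity)

/-- Expansion at `x = 0` of the generating series of `roughSum`, with its logarithmic factor
removed. -/
lemma exists_regular_expansion (hy : 2 ≤ y) : ∃ (A B : ℝ⟦X⟧) (η : ℕ → ℝ → ℝ) (C : ℝ), 0 ≤ C ∧
    (∀ n, |coeff n A| ≤ C * (1 / 3) ^ n) ∧
    (∀ n, |coeff n B| ≤ C * (n + 1) * (1 / 3) ^ n) ∧
    ev A 1 = ∏ p ∈ primesUpTo y, (1 - 1 / (p : ℝ)) ∧
    ev B 2 = 2 * (c y * dSifted y) ∧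
    (∀ n, ContinuousOn (η n) (Set.Icc 0 1)) ∧
    (∀ n, ∀ x ∈ Set.Icc (0 : ℝ) 1,
      |η n x - coeff n A - x * coeff n B| ≤ C * (n + 1) ^ 2 * (1 / 3) ^ n * x ^ 2) ∧
    ∀ k, ∀ x : ℝ, 0 < x → roughSum k y (1 + x) =
      ∑ q ∈ antidiagonal k, η q.1 x * ((-Real.log x) ^ q.2 / q.2.factorial) := by
  obtain ⟨a1, a2, ha1, ha2, ha2c⟩ := regLog_derivs (y := y)
  have hIcc : ∀ x ∈ Set.Icc (0 : ℝ) 1, -(1 / 4) < x := fun x hx => by linarith [hx.1]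
  have hHc : ∀ i, ContinuousOn (higherSum y i) (Set.Icc 0 1) := fun i x hx =>
    (hasDerivAt_higherSum hy i (hIcc x hx)).continuousAt.continuousWithinAt
  have hu0 : ∀ x ∈ Set.Icc (0 : ℝ) 1, HasDerivAt (fun x => regLog y x - higherSum y 0 x)
      (a1 x + higherSum y 1 x) x := fun x hx => by
    have h := (ha1 x hx).fun_sub (hasDerivAt_higherSum hy 0 (hIcc x hx))
    rwa [sub_neg_eq_add] at h
  have hu1 : ∀ x ∈ Set.Icc (0 : ℝ) 1, HasDerivAt (fun x => a1 x + higherSum y 1 x)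
      (a2 x - higherSum y 2 x) x := fun x hx => by
    have h := (ha2 x hx).fun_add (hasDerivAt_higherSum hy 1 (hIcc x hx))
    rwa [← sub_eq_add_neg] at h
  obtain ⟨K0, hK0, hK0'⟩ := exists_abs_le_of_continuousOn
    (f := fun x => regLog y x - higherSum y 0 x)
    fun x hx => (hu0 x hx).continuousAt.continuousWithinAt
  obtain ⟨K1, hK1, hK1'⟩ := exists_abs_le_of_continuousOn
    (f := fun x => a1 x + higherSum y 1 x)
    fun x hx => (hu1 x hx).continuousAt.continuousWithinAt
  obtain ⟨K2, hK2, hK2'⟩ := exists_abs_le_of_continuousOn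
    (f := fun x => a2 x - higherSum y 2 x) (ha2c.sub (hHc 2))
  set L1 : ℝ → ℝ⟦X⟧ := fun x => consSeries (a1 x + higherSum y 1 x)
    fun m => -primeSum y 1 ((m + 2) * (1 + x)) with hL1
  set L2 : ℝ → ℝ⟦X⟧ := fun x => consSeries (a2 x - higherSum y 2 x)
    fun m => (m + 2) * primeSum y 2 ((m + 2) * (1 + x)) with hL2
  have hD := fun i => primeSum_nonneg (y := y) i 2
  -- The summand 5 K0 absorbs the coefficient of X, as (5 K0)/5 = K0; the other is the bound of
  -- `primeSum_zero_le`.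
  obtain ⟨C0, hC0, hE⟩ := exists_abs_coeff_expS_le (K := 5 * K0 + 25 * primeSum y 0 2)
    (by have := hD 0; positivity)
  have hE' : ∀ x ∈ Set.Icc (0 : ℝ) 1, ∀ n,
      |coeff n (expS (regSeries y x))| ≤ C0 * (1 / 3) ^ n := by
    refine fun x hx => hE _ (constantCoeff_regSeries x) fun m => ?_
    have h2 := hD 0
    match m with
    | 0 => simp [regSeries, coeff_consSeries_zero]
    | 1 =>
      rw [regSeries, coeff_consSeries_one]
      refine (hK0' x hx).trans ?_
      norm_num
      linarith
    | m + 2 =>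
      rw [regSeries, coeff_consSeries_add_two,
        abs_of_nonneg (div_nonneg (primeSum_nonneg _ _) (by positivity))]
      push_cast
      gcongr
      refine (primeSum_zero_le hy m hx.1).trans ?_
      gcongr
      linarith
  have hB1 : ∀ x ∈ Set.Icc (0 : ℝ) 1, ∀ n,
      |coeff n (L1 x)| ≤ (3 * K1 + 9 * primeSum y 1 2) * (1 / 3) ^ n := fun x hx n => by
    have h := abs_coeff_consSeries_le hK1 (hD 1) (α := 0) (hK1' x hx)
      (v := fun m => -primeSum y 1 ((m + 2) * (1 + x))) (fun m => by
        rw [abs_neg, abs_of_nonneg (primeSum_nonneg _ _), pow_zero, mul_one, mul_comm (primeSum _ _ _)]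
        exact primeSum_mul_le hy 1 m hx.1) n
    simpa using h
  have hB2 : ∀ x ∈ Set.Icc (0 : ℝ) 1, ∀ n,
      |coeff n (L2 x)| ≤ (3 * K2 + 9 * primeSum y 2 2) * (n + 1) * (1 / 3) ^ n := fun x hx n => by
    have h := abs_coeff_consSeries_le hK2 (hD 2) (α := 1) (hK2' x hx)
      (v := fun m => (m + 2) * primeSum y 2 ((m + 2) * (1 + x))) (fun m => by
        rw [abs_of_nonneg (mul_nonneg (by positivity) (primeSum_nonneg _ _)), pow_one]
        calc _ ≤ ((m : ℝ) + 2) * ((1 / 3) ^ m * primeSum y 2 2) := by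
              gcongr; exact primeSum_mul_le hy 2 m hx.1
          _ = _ := by ring) n
    simpa using h
  set C1 := C0 + (3 * K1 + 9 * primeSum y 1 2) + (3 * K2 + 9 * primeSum y 2 2) with hC1
  have hC1a : 0 ≤ 3 * K1 + 9 * primeSum y 1 2 := by have := hD 1; positivity
  have hC1b : 0 ≤ 3 * K2 + 9 * primeSum y 2 2 := by have := hD 2; positivity
  have hC1' : 0 ≤ C1 := by positivity
  have hE1 : ∀ x ∈ Set.Icc (0 : ℝ) 1, ∀ n,
      |coeff n (expS (regSeries y x))| ≤ C1 * (1 / 3) ^ n := fun x hx n =>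
    (hE' x hx n).trans (by gcongr; linarith)
  have hB1' : ∀ x ∈ Set.Icc (0 : ℝ) 1, ∀ n, |coeff n (L1 x)| ≤ C1 * (1 / 3) ^ n := fun x hx n =>
    (hB1 x hx n).trans (by gcongr; linarith)
  have hB2' : ∀ x ∈ Set.Icc (0 : ℝ) 1, ∀ n,
      |coeff n (L2 x)| ≤ C1 * (n + 1) * (1 / 3) ^ n := fun x hx n =>
    (hB2 x hx n).trans (by gcongr; linarith)
  have hd0 : ∀ n, ∀ x ∈ Set.Icc (0 : ℝ) 1, HasDerivWithinAt
      (fun t => coeff n (regSeries y t)) (coeff n (L1 x)) (Set.Icc 0 1) x := fun n x hx => by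
    refine hasDerivWithinAt_coeff_consSeries (hu0 x hx).hasDerivWithinAt (fun m => ?_) n
    have hm : (m : ℝ) + 2 ≠ 0 := by positivity
    have h := (hasDerivAt_primeSum_mul (y := y) 0 m (hIcc x hx)).div_const (m + 2 : ℝ)
    convert! h.hasDerivWithinAt using 1
    field_simp
  have hd1 : ∀ n, ∀ x ∈ Set.Icc (0 : ℝ) 1, HasDerivWithinAt
      (fun t => coeff n (L1 t)) (coeff n (L2 x)) (Set.Icc 0 1) x := fun n x hx => by
    refine hasDerivWithinAt_coeff_consSeries (hu1 x hx).hasDerivWithinAt (fun m => ?_) n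
    have h := (hasDerivAt_primeSum_mul (y := y) 1 m (hIcc x hx)).neg
    convert! h.hasDerivWithinAt using 1
    ring
  have h00 : (0 : ℝ) ∈ Set.Icc (0 : ℝ) 1 := by simp
  have hbB : ∀ n, |coeff n (expS (regSeries y 0) * L1 0)| ≤ C1 * C1 * (n + 1) * (1 / 3) ^ n := by
    intro n
    have := abs_coeff_mul_le (F := expS (regSeries y 0)) (G := L1 0) (r := 1 / 3) (α := 0) (β := 0)
      (by norm_num) hC1' hC1'
      (fun n => by simpa using hE1 0 h00 n) (fun n => by simpa using hB1' 0 h00 n) n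
    simpa using this
  have tE : Tame (expS (regSeries y 0)) := ⟨C1, 0, hC1', fun n => by simpa using hE1 0 h00 n⟩
  have tL1 : Tame (L1 0) := ⟨C1, 0, hC1', fun n => by simpa using hB1' 0 h00 n⟩
  have tL : Tame (regSeries y 0) := by
    refine ⟨3 * K0 + 9 * primeSum y 0 2, 0, by have := hD 0; positivity, ?_⟩
    refine abs_coeff_consSeries_le hK0 (hD 0) (hK0' 0 h00) fun m => ?_
    rw [abs_of_nonneg (div_nonneg (primeSum_nonneg _ _) (by positivity)), pow_zero, mul_one]
    refine (div_le_self (primeSum_nonneg _ _) (by linarith [m.cast_nonneg (α := ℝ)])).trans ?_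
    rw [mul_comm _ ((1 / 3 : ℝ) ^ m)]
    exact primeSum_mul_le hy 0 m le_rfl
  have hev : ∀ z : ℝ, |z| < 3 → ev (regSeries y 0) z = (regLog y 0 - higherSum y 0 0) * z +
      ∑' m : ℕ, primeSum y 0 ((m + 2) * (1 + 0)) / (m + 2) * z ^ (m + 2) := fun z hz => by
    refine ev_consSeries ?_
    have := (summable_nat_add_iff 2).2 (tL.summable hz)
    simpa only [regSeries, coeff_consSeries_add_two] using this
  have hH0 : Summable (fun m : ℕ => primeSum y 0 ((m + 2) * (1 + 0)) / ((m : ℝ) + 2)) := by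
    refine (summable_higherSum hy 0 (x := 0) (by norm_num)).congr fun m => ?_
    rw [pow_zero]; ring
  have hH0' : higherSum y 0 0 =
      ∑' m : ℕ, primeSum y 0 ((m + 2) * (1 + 0)) / ((m : ℝ) + 2) :=
    tsum_congr fun m => by rw [pow_zero]; ring
  -- At X = 1 the sum over m ≥ 2 cancels the subtracted `higherSum`, leaving exp(`regLog y 0`).
  have hev1 : ev (expS (regSeries y 0)) 1 = ∏ p ∈ primesUpTo y, (1 - 1 / (p : ℝ)) := by
    rw [ev_expS (constantCoeff_regSeries 0) tE tL (by norm_num), hev 1 (by norm_num),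
      ← exp_regLog_zero, hH0']
    simp only [one_pow, mul_one, sub_add_cancel]
  have hev2 : ev (expS (regSeries y 0)) 2 = dSifted y := by
    rw [ev_expS (constantCoeff_regSeries 0) tE tL (by norm_num), hev 2 (by norm_num),
      dSifted_eq hy, ← exp_regLog_zero, (hasProd_dFactor hy).tprod_eq, ← Real.exp_nat_mul,
      ← Real.exp_add, hH0']
    congr 1
    -- Splitting 2^m = (2^m - 2) + 2: the second part cancels twice `higherSum`, the first is the
    -- logarithm of the product of the `dFactor`s.
    have h2 : ∑' m : ℕ, primeSum y 0 ((m + 2) * (1 + 0)) / (m + 2) * (2 : ℝ) ^ (m + 2) =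
        ∑' m : ℕ, ((2 : ℝ) ^ (m + 2) - 2) / (m + 2) * primeSum y 0 ((m + 2) * (1 + 0)) +
        2 * ∑' m : ℕ, primeSum y 0 ((m + 2) * (1 + 0)) / ((m : ℝ) + 2) := by
      rw [← tsum_mul_left, ← (hasSum_log_dFactor hy).1.tsum_add (hH0.mul_left 2)]
      exact tsum_congr fun m => by ring
    rw [h2]
    push_cast
    ring
  have hev3 : ev (L1 0) 2 = 2 * c y := by
    have hs : Summable fun m : ℕ => -primeSum y 1 ((m + 2) * (1 + 0)) * (2 : ℝ) ^ (m + 2) := by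
      have := (summable_nat_add_iff 2).2 (tL1.summable (x := 2) (by norm_num))
      simpa only [hL1, coeff_consSeries_add_two] using this
    rw [hL1, ev_consSeries hs]
    have hH1 : Summable fun m : ℕ => primeSum y 1 ((m + 2) * (1 + 0)) := by
      refine (summable_higherSum hy 1 (x := 0) (by norm_num)).congr fun m => ?_
      have : (m : ℝ) + 2 ≠ 0 := by positivity
      rw [pow_one, div_self this, one_mul]
    have hH1' : higherSum y 1 0 = ∑' m : ℕ, primeSum y 1 ((m + 2) * (1 + 0)) :=
      tsum_congr fun m => by
        have : (m : ℝ) + 2 ≠ 0 := by positivity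
        rw [pow_one, div_self this, one_mul]
    -- The same splitting, one derivative up, yields the series of `cTerm`.
    have h2 : ∑' m : ℕ, -primeSum y 1 ((m + 2) * (1 + 0)) * (2 : ℝ) ^ (m + 2) =
        -(∑' m : ℕ, ((2 : ℝ) ^ (m + 2) - 2) * primeSum y 1 ((m + 2) * (1 + 0))) -
        2 * ∑' m : ℕ, primeSum y 1 ((m + 2) * (1 + 0)) := by
      rw [← tsum_mul_left, ← tsum_neg, ← (hasSum_cTerm hy).1.neg.tsum_sub (hH1.mul_left 2)]
      exact tsum_congr fun m => by ring
    rw [h2, hH1', ← (hasSum_cTerm hy).2.tsum_eq, tsum_mul_left,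
      (ha1 0 h00).unique hasDerivAt_regLog_zero, c]
    ring
  refine ⟨expS (regSeries y 0), expS (regSeries y 0) * L1 0,
    fun n x => coeff n (expS (regSeries y x)), C1 + C1 * C1 + (C1 ^ 3 + C1 ^ 2), by positivity,
    fun n => (hE1 0 h00 n).trans ?_, fun n => (hbB n).trans ?_, hev1, ?_, fun n x hx => ?_,
    fun n x hx => ?_, fun k x hx => roughSum_eq hy k hx⟩
  · gcongr
    have : 0 ≤ C1 * C1 + (C1 ^ 3 + C1 ^ 2) := by positivity
    linarith
  · gcongr
    have : 0 ≤ C1 + (C1 ^ 3 + C1 ^ 2) := by positivity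
    linarith
  · rw [tE.ev_mul tL1 (by norm_num), hev2, hev3]; ring
  · exact (hasDerivWithinAt_coeff_expS constantCoeff_regSeries (constantCoeff_consSeries _ _)
      (fun n => hd0 n x hx) n).continuousWithinAt
  · refine (exists_coeff_expS_taylor hC1' constantCoeff_regSeries
      (fun t => constantCoeff_consSeries _ _) hd0 hd1 hE1 hB1' hB2' hx n).trans ?_
    have : 0 ≤ C1 + C1 * C1 := by positivity
    have h : C1 ^ 3 + C1 ^ 2 ≤ C1 + C1 * C1 + (C1 ^ 3 + C1 ^ 2) := by linarith
    have h1 := mul_le_mul_of_nonneg_right h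
      (by positivity : 0 ≤ ((n : ℝ) + 1) ^ 2 * (1 / 3) ^ n * x ^ 2)
    linarith

/-! ### From the Erdős sum to integrals and completed series. -/

lemma three_le_of_mem_roughAlmostPrimes {k n : ℕ} (hk : 1 ≤ k) (hy : 2 ≤ y) (hn : n ∈ roughAlmostPrimes k y) :
    3 ≤ n := by
  have h1 : n ≠ 1 := by
    rintro rfl
    have := hn.2.1
    simp at this
    omega
  obtain ⟨p, hp, hd⟩ := Nat.exists_prime_and_dvd h1
  have h2 := hn.2.2 p hp hd
  have h3 := Nat.le_of_dvd (Nat.pos_of_ne_zero hn.1) hd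
  omega

lemma hasSum_integral_rpow {k : ℕ}
    (hint : IntegrableOn (fun x : ℝ => roughSum k y (1 + x)) (Set.Ioc 0 1)) :
    HasSum (fun n : roughAlmostPrimes k y =>
      ∫ x in Set.Ioc (0 : ℝ) 1, ((n : ℕ) : ℝ) ^ (-(1 + x)))
      (∫ x in Set.Ioc (0 : ℝ) 1, roughSum k y (1 + x)) := by
  refine hasSum_integral_of_dominated_convergence
    (fun (n : roughAlmostPrimes k y) x => ((n : ℕ) : ℝ) ^ (-(1 + x))) (fun n => ?_) (fun n => ?_)
    ?_ hint ?_
  · have hn0 : ((n : ℕ) : ℝ) ≠ 0 := by exact_mod_cast n.2.1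
    exact (Continuous.rpow continuous_const (by fun_prop) fun x =>
      Or.inl hn0).aestronglyMeasurable
  · exact Filter.Eventually.of_forall fun x => by
      rw [Real.norm_of_nonneg (by positivity)]
  · filter_upwards [ae_restrict_mem measurableSet_Ioc] with x hx
    exact summable_roughSum k (by linarith [hx.1])
  · filter_upwards [ae_restrict_mem measurableSet_Ioc] with x hx
    exact (summable_roughSum k (by linarith [hx.1])).hasSum

/-- The sifted Erdős sum as an integral, up to a remainder controlled by `roughSum k y 2`. -/
lemma f_eq_integral (hy : 2 ≤ y) {k : ℕ} (hk : 1 ≤ k)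
    (hint : IntegrableOn (fun x : ℝ => roughSum k y (1 + x)) (Set.Ioc 0 1)) :
    Summable (fun n : roughAlmostPrimes k y => term n) ∧
    |f k y - ∫ x in Set.Ioc (0 : ℝ) 1, roughSum k y (1 + x)| ≤ roughSum k y 2 := by
  have h1 := hasSum_integral_rpow hint
  -- Every such n is at least 3 > e, so dividing by log n only helps.
  have hlog : ∀ n : roughAlmostPrimes k y, 1 ≤ Real.log (n : ℕ) := fun n => by
    have h3 : (3 : ℝ) ≤ (n : ℕ) := by exact_mod_cast three_le_of_mem_roughAlmostPrimes hk hy n.2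
    rw [Real.le_log_iff_exp_le (by linarith)]
    linarith [Real.exp_one_lt_d9]
  have h20 : ∀ n : roughAlmostPrimes k y,
      0 ≤ ((n : ℕ) : ℝ) ^ (-(2 : ℝ)) / Real.log (n : ℕ) := fun n => by
    have := hlog n
    positivity
  have h2le : ∀ n : roughAlmostPrimes k y,
      ((n : ℕ) : ℝ) ^ (-(2 : ℝ)) / Real.log (n : ℕ) ≤ ((n : ℕ) : ℝ) ^ (-(2 : ℝ)) := fun n =>
    div_le_self (by positivity) (hlog n)
  have hs := summable_roughSum (y := y) k (s := 2) (by norm_num)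
  have h2 : Summable fun n : roughAlmostPrimes k y =>
      ((n : ℕ) : ℝ) ^ (-(2 : ℝ)) / Real.log (n : ℕ) := hs.of_nonneg_of_le h20 h2le
  have h3 : ∀ n : roughAlmostPrimes k y, (∫ x in Set.Ioc (0 : ℝ) 1, ((n : ℕ) : ℝ) ^ (-(1 + x))) +
      ((n : ℕ) : ℝ) ^ (-(2 : ℝ)) / Real.log (n : ℕ) = term n := fun n =>
    (integral_natCast_rpow (by have := three_le_of_mem_roughAlmostPrimes hk hy n.2; omega)).symm
  have h4 := h1.add h2.hasSum
  simp only [h3] at h4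
  refine ⟨h4.summable, ?_⟩
  rw [f, h4.tsum_eq, add_sub_cancel_left, abs_of_nonneg (tsum_nonneg h20)]
  exact h2.tsum_le_tsum h2le hs

/-- The tail is geometric of ratio z/3 < 1; n + k + 2 ≤ (n+1)(k+2) separates its dependence on k. -/
lemma abs_ev_sub_sum_le {F : ℝ⟦X⟧} {C z : ℝ} (hC : 0 ≤ C) (hz : 0 ≤ z) (hz3 : z < 3)
    (hF : ∀ n, |coeff n F| ≤ C * (n + 1) * (1 / 3) ^ n) : ∃ D, 0 ≤ D ∧ ∀ k : ℕ,
    |∑ i ∈ range (k + 1), coeff i F * z ^ i - ev F z| ≤ D * (k + 2) * (z / 3) ^ (k + 1) := by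
  have hr1 : z / 3 < 1 := by rwa [div_lt_one (by norm_num)]
  have hS := summable_succ_pow_mul_geometric 1 (r := z / 3) (by positivity) hr1
  have hT : Tame F := ⟨C, 1, hC, by simpa using hF⟩
  refine ⟨C * ∑' n : ℕ, ((n : ℝ) + 1) ^ 1 * (z / 3) ^ n,
    mul_nonneg hC (tsum_nonneg fun n => by positivity), fun k => ?_⟩
  rw [ev, ← (hT.summable (x := z) (by rwa [abs_of_nonneg hz])).sum_add_tsum_nat_add (k + 1),
    sub_add_cancel_left, abs_neg]
  have hb := hS.mul_left (C * (k + 2) * (z / 3) ^ (k + 1))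
  have hle : ∀ n : ℕ, ‖coeff (n + (k + 1)) F * z ^ (n + (k + 1))‖ ≤
      C * (k + 2) * (z / 3) ^ (k + 1) * (((n : ℝ) + 1) ^ 1 * (z / 3) ^ n) := fun n => by
    rw [norm_mul, norm_pow, Real.norm_of_nonneg hz, Real.norm_eq_abs]
    have h1 : ((n + (k + 1) : ℕ) : ℝ) + 1 ≤ (n + 1) * (k + 2) := by
      push_cast
      nlinarith [mul_nonneg (n.cast_nonneg (α := ℝ)) (k.cast_nonneg (α := ℝ)),
        n.cast_nonneg (α := ℝ)]
    calc _ ≤ C * ((n + (k + 1) : ℕ) + 1) * (1 / 3) ^ (n + (k + 1)) * z ^ (n + (k + 1)) := by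
          gcongr; exact hF _
      _ ≤ C * ((n + 1) * (k + 2)) * (1 / 3) ^ (n + (k + 1)) * z ^ (n + (k + 1)) := by gcongr
      _ = _ := by
          rw [pow_one, mul_assoc _ ((1 / 3 : ℝ) ^ _), ← mul_pow, pow_add,
            show 1 / 3 * z = z / 3 by ring]
          ring
  refine (tsum_of_norm_bounded hb.hasSum hle).trans (le_of_eq ?_)
  rw [tsum_mul_left]
  ring

/-- The integral of one coefficient of the expansion against a power of the logarithm. -/
lemma integral_coeff_mul_log {g : ℝ → ℝ} {a b E : ℝ} (hg : ContinuousOn g (Set.Icc 0 1))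
    (hE : ∀ x ∈ Set.Icc (0 : ℝ) 1, |g x - a - x * b| ≤ E * x ^ 2) (j : ℕ) :
    IntegrableOn (fun x => g x * ((-Real.log x) ^ j / j.factorial)) (Set.Ioc 0 1) ∧
    |(∫ x in Set.Ioc (0 : ℝ) 1, g x * ((-Real.log x) ^ j / j.factorial)) -
      (a + b * (1 / 2) ^ (j + 1))| ≤ E * (1 / 3) ^ (j + 1) := by
  obtain ⟨i0, v0⟩ := integral_pow_mul_neg_log_pow 0 j
  obtain ⟨i1, v1⟩ := integral_pow_mul_neg_log_pow 1 j
  obtain ⟨i2, v2⟩ := integral_pow_mul_neg_log_pow 2 j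
  simp only [pow_zero, one_mul, pow_one] at i0 v0 i1 v1
  norm_num at v0 v1 v2
  obtain ⟨K, hK, hK'⟩ := exists_abs_le_of_continuousOn hg
  have hgm : AEStronglyMeasurable g (volume.restrict (Set.Ioc 0 1)) :=
    (hg.mono Set.Ioc_subset_Icc_self).aestronglyMeasurable measurableSet_Ioc
  have hint : IntegrableOn (fun x => g x * ((-Real.log x) ^ j / j.factorial)) (Set.Ioc 0 1) := by
    refine Integrable.bdd_mul (c := K) i0 hgm ?_
    filter_upwards [ae_restrict_mem measurableSet_Ioc] with x hx
    exact hK' x (Set.Ioc_subset_Icc_self hx)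
  refine ⟨hint, ?_⟩
  have hm : IntegrableOn (fun x => a * ((-Real.log x) ^ j / j.factorial) +
      b * (x * ((-Real.log x) ^ j / j.factorial))) (Set.Ioc 0 1) :=
    (i0.const_mul a).add (i1.const_mul b)
  have hmv : ∫ x in Set.Ioc (0 : ℝ) 1, (a * ((-Real.log x) ^ j / j.factorial) +
      b * (x * ((-Real.log x) ^ j / j.factorial))) = a + b * (1 / 2) ^ (j + 1) := by
    rw [integral_add (i0.const_mul a) (i1.const_mul b), integral_const_mul, integral_const_mul,
      v0, v1, one_div, inv_pow, mul_one]
  have hev : E * (1 / 3) ^ (j + 1) =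
      ∫ x in Set.Ioc (0 : ℝ) 1, E * (x ^ 2 * ((-Real.log x) ^ j / j.factorial)) := by
    rw [integral_const_mul, v2, one_div, inv_pow]
  rw [← hmv, hev, ← integral_sub hint hm, ← Real.norm_eq_abs]
  refine norm_integral_le_of_norm_le (i2.const_mul E) ?_
  filter_upwards [ae_restrict_mem measurableSet_Ioc] with x hx
  have hl : 0 ≤ (-Real.log x) ^ j / j.factorial := by
    have := Real.log_nonpos hx.1.le hx.2
    have : 0 ≤ -Real.log x := by linarith
    positivity
  rw [show g x * ((-Real.log x) ^ j / j.factorial) - (a * ((-Real.log x) ^ j / j.factorial) +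
      b * (x * ((-Real.log x) ^ j / j.factorial))) =
      (g x - a - x * b) * ((-Real.log x) ^ j / j.factorial) by ring, norm_mul,
    Real.norm_of_nonneg hl, ← mul_assoc]
  exact mul_le_mul_of_nonneg_right (hE x (Set.Ioc_subset_Icc_self hx)) hl

end ErdosSum

/-! ### The asymptotic formula. -/

theorem theorem4 (y : ℕ) (hy : 2 ≤ y) :
    Summable (fun p : ErdosSum.primesAbove y => ErdosSum.cTerm p) ∧
    Multipliable (fun p : ErdosSum.primesAbove 2 => ErdosSum.dFactor p) ∧
    (∀ k : ℕ, 1 ≤ k →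
      Summable (fun n : ErdosSum.roughAlmostPrimes k y => ErdosSum.term n)) ∧
    ∃ C : ℝ, ∀ k : ℕ, 1 ≤ k →
      |ErdosSum.f k y -
          (∏ p ∈ ErdosSum.primesUpTo y, (1 - 1 / (p : ℝ))
            + ErdosSum.c y * ErdosSum.dSifted y / 2 ^ k)|
        ≤ C * ((k : ℝ) ^ 3 / 3 ^ k) := by
  open ErdosSum PowerSeries Finset MeasureTheory in
  obtain ⟨A, B, η, C, hC, hA, hB, hA1, hB2, hηc, hη, hrough⟩ := exists_regular_expansion hy
  have hA' : ∀ n, |coeff n A| ≤ C * (n + 1) * (1 / 3) ^ n := fun n => (hA n).trans (by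
    have : C ≤ C * (n + 1) := le_mul_of_one_le_right hC (by linarith [n.cast_nonneg (α := ℝ)])
    gcongr)
  obtain ⟨D1, hD1, hT1⟩ := abs_ev_sub_sum_le hC zero_le_one (by norm_num) hA'
  obtain ⟨D2, hD2, hT2⟩ := abs_ev_sub_sum_le hC zero_le_two (by norm_num) hB
  have hcoef := fun n j => integral_coeff_mul_log (hηc n) (hη n) j
  have hint : ∀ k, IntegrableOn (fun x : ℝ => roughSum k y (1 + x)) (Set.Ioc 0 1) := fun k => by
    have h := integrable_finsetSum (μ := volume.restrict (Set.Ioc 0 1)) (antidiagonal k)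
      (f := fun q x => η q.1 x * ((-Real.log x) ^ q.2 / q.2.factorial))
      fun q _ => (hcoef q.1 q.2).1
    refine h.congr ?_
    filter_upwards [ae_restrict_mem measurableSet_Ioc] with x hx
    exact (hrough k x hx.1).symm
  have hsum : Summable fun p : primesAbove y => cTerm p := by
    have := (hasSum_cTerm hy).2.summable.mul_left (1 / 2)
    refine this.congr fun p => by ring
  -- The four summands bound the Taylor remainder, the two completed tails, and `roughSum k y 2`.
  refine ⟨hsum, (hasProd_dFactor le_rfl).multipliable,
    fun k hk => (f_eq_integral hy hk (hint k)).1, 8 * C + 3 * D1 + 3 * D2 + 24 * C,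
    fun k hk => ?_⟩
  have hk1 : (1 : ℝ) ≤ k := by exact_mod_cast hk
  have hI : |(∫ x in Set.Ioc (0 : ℝ) 1, roughSum k y (1 + x)) -
      ∑ q ∈ antidiagonal k, (coeff q.1 A + coeff q.1 B * (1 / 2) ^ (q.2 + 1))| ≤
      8 * C * ((k : ℝ) ^ 3 / 3 ^ k) := by
    have h1 : ∫ x in Set.Ioc (0 : ℝ) 1, roughSum k y (1 + x) = ∑ q ∈ antidiagonal k,
        ∫ x in Set.Ioc (0 : ℝ) 1, η q.1 x * ((-Real.log x) ^ q.2 / q.2.factorial) := by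
      rw [← integral_finsetSum (antidiagonal k) (fun q _ => (hcoef q.1 q.2).1)]
      exact setIntegral_congr_fun measurableSet_Ioc fun x hx => hrough k x hx.1
    rw [h1, ← sum_sub_distrib]
    refine (abs_sum_le_sum_abs _ _).trans ?_
    calc _ ≤ ∑ q ∈ antidiagonal k, C * (k + 1) ^ 2 * (1 / 3) ^ k := by
          refine sum_le_sum fun q hq => (hcoef q.1 q.2).2.trans ?_
          have hq' := mem_antidiagonal.1 hq
          have hq1 : (q.1 : ℝ) ≤ k := by exact_mod_cast (by omega : q.1 ≤ k)
          -- The x^2 remainder integrates to 3^(-(j+1)), which joins the 3^(-n) of the coefficient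
          -- to give 3^(-(k+1)).
          rw [mul_assoc, ← pow_add]
          gcongr C * (?_ + 1) ^ 2 * ?_
          exact pow_le_pow_of_le_one (by norm_num) (by norm_num) (by omega)
      _ = C * (k + 1) ^ 3 / 3 ^ k := by
          rw [sum_const, Nat.card_antidiagonal, nsmul_eq_mul, one_div, inv_pow]
          push_cast
          ring
      _ ≤ C * (2 * k) ^ 3 / 3 ^ k := by gcongr; linarith
      _ = _ := by ring
  have hM : ∑ q ∈ antidiagonal k, (coeff q.1 A + coeff q.1 B * (1 / 2) ^ (q.2 + 1)) =
      ∑ i ∈ range (k + 1), coeff i A * 1 ^ i +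
        (1 / 2) ^ (k + 1) * ∑ i ∈ range (k + 1), coeff i B * 2 ^ i := by
    rw [Nat.sum_antidiagonal_eq_sum_range_succ_mk, sum_add_distrib, mul_sum]
    congr 1
    · simp
    · refine sum_congr rfl fun i hi => ?_
      have hi' : i ≤ k := by have := mem_range.1 hi; omega
      have : (1 / 2 : ℝ) ^ (k + 1) = (1 / 2) ^ (k - i + 1) * (1 / 2) ^ i := by
        rw [← pow_add]; congr 1; omega
      rw [this, one_div, inv_pow _ i]
      field_simp
  have hk3 : (k : ℝ) ≤ k ^ 3 := le_self_pow₀ hk1 (by norm_num)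
  have h1 : |∑ i ∈ range (k + 1), coeff i A * 1 ^ i - ev A 1| ≤ 3 * D1 * ((k : ℝ) ^ 3 / 3 ^ k) := by
    refine (hT1 k).trans ?_
    have : ((1 : ℝ) / 3) ^ (k + 1) ≤ 1 / 3 ^ k := by
      rw [one_div_pow]; gcongr <;> norm_num
    calc D1 * (k + 2) * (1 / 3) ^ (k + 1) ≤ D1 * (3 * k ^ 3) * (1 / 3 ^ k) := by
          gcongr; linarith
      _ = _ := by ring
  have h2 : |(1 / 2) ^ (k + 1) * ∑ i ∈ range (k + 1), coeff i B * 2 ^ i -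
      (1 / 2) ^ (k + 1) * ev B 2| ≤ 3 * D2 * ((k : ℝ) ^ 3 / 3 ^ k) := by
    rw [← mul_sub, abs_mul, abs_of_nonneg (by positivity)]
    have : ((1 : ℝ) / 3) ^ (k + 1) ≤ 1 / 3 ^ k := by
      rw [one_div_pow]; gcongr <;> norm_num
    calc _ ≤ (1 / 2) ^ (k + 1) * (D2 * (k + 2) * (2 / 3) ^ (k + 1)) := by gcongr; exact hT2 k
      _ = D2 * (k + 2) * ((1 / 2 * (2 / 3)) ^ (k + 1)) := by rw [mul_pow]; ring
      _ = D2 * (k + 2) * (1 / 3) ^ (k + 1) := by norm_num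
      _ ≤ D2 * (3 * k ^ 3) * (1 / 3 ^ k) := by gcongr; linarith
      _ = _ := by ring
  -- At x = 1 the logarithm vanishes, so only the term with j = 0 survives and `roughSum k y 2` is
  -- the single value η k 1.
  have h3 : roughSum k y 2 ≤ 24 * C * ((k : ℝ) ^ 3 / 3 ^ k) := by
    have e1 := hrough k 1 one_pos
    rw [sum_eq_single (k, 0)] at e1
    · norm_num at e1
      have e2 := hη k 1 (by simp)
      have e3 := abs_add_three (η k 1 - coeff k A - 1 * coeff k B) (coeff k A) (coeff k B)
      rw [show η k 1 - coeff k A - 1 * coeff k B + coeff k A + coeff k B = η k 1 by ring] at e3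
      have hp : (0 : ℝ) ≤ (1 / 3) ^ k := by positivity
      have hCp : 0 ≤ C * (1 / 3) ^ k := by positivity
      have e4 : roughSum k y 2 ≤ 3 * (C * (1 / 3) ^ k * (2 * k) ^ 3) := by
        rw [e1]
        have f1 : (1 : ℝ) ≤ (2 * k) ^ 3 := one_le_pow₀ (by linarith)
        have f2 : (k : ℝ) + 1 ≤ (2 * k) ^ 3 := by
          calc (k : ℝ) + 1 ≤ 2 * k := by linarith
            _ ≤ _ := le_self_pow₀ (by linarith) (by norm_num)
        have f3 : ((k : ℝ) + 1) ^ 2 ≤ (2 * k) ^ 3 := by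
          calc ((k : ℝ) + 1) ^ 2 ≤ (2 * k) ^ 2 := by gcongr; linarith
            _ ≤ _ := pow_le_pow_right₀ (by linarith) (by norm_num)
        have g1 := mul_le_mul_of_nonneg_left f1 hCp
        have g2 := mul_le_mul_of_nonneg_left f2 hCp
        have g3 := mul_le_mul_of_nonneg_left f3 hCp
        have := hA k
        have := hB k
        have := le_abs_self (η k 1)
        rw [one_pow, mul_one] at e2
        linarith
      refine e4.trans (le_of_eq ?_)
      rw [one_div, inv_pow]
      ring
    · intro q hq hne
      have hq2 : q.2 ≠ 0 := fun h => hne (by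
        have := mem_antidiagonal.1 hq
        exact Prod.ext (by simp; omega) h)
      simp [hq2]
    · intro h
      exact absurd (mem_antidiagonal.2 (add_zero k)) h
  have h0 := (f_eq_integral hy hk (hint k)).2
  rw [hM] at hI
  rw [hA1] at h1
  rw [hB2] at h2
  have hcd : (1 / 2 : ℝ) ^ (k + 1) * (2 * (c y * dSifted y)) = c y * dSifted y / 2 ^ k := by
    rw [pow_succ, one_div, inv_pow]
    field_simp
  rw [hcd] at h2
  rw [abs_le] at h0 hI h1 h2 ⊢
  constructor <;> linarith [h0.1, h0.2, hI.1, hI.2, h1.1, h1.2, h2.1, h2.2]
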